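/- Let $A_\star,\widehat A\in\mathbb R^{n\times n}$, $B_\star,\widehat B\in\mathbb R^{n\times m}$, and let $R_x\in\mathbb R^{n\times n}$, $R_u\in\mathbb R^{m\times m}$ be symmetric cost matrices with $R_x\succeq I$ and $R_u\succeq I$. A pair $(A,B)$ is called stabilizable if there is $K\in\mathbb R^{m\times n}$ such that all (complex) eigenvalues of $A+BK$ have modulus less than $1$. For stabilizable $(A,B)$ let $P_\infty(A,B)$ be the unique positive semidefinite solution of the discrete algebraic Riccati equation $$P=A^\top PA-A^\top PB(R_u+B^\top PB)^{-1}B^\top PA+R_x,$$ and let $K_\infty(A,B)=-(R_u+B^\top P_\infty(A,B)B)^{-1}B^\top P_\infty(A,B)A$. Write $\|\cdot\|_{\mathrm{op}}$ and $\|\cdot\|_{F}$ for the spectral and the Frobenius norm, and $X^{1/2}$ for the positive semidefinite square root of a positive semidefinite matrix $X$. Suppose that $(A_\star,B_\star)$ is stabilizable, and put $P_\star=P_\infty(A_\star,B_\star)$, $K_\star=K_\infty(A_\star,B_\star)$, $\epsilon_\circ=\max\{\|A_\star-\widehat A\|_\circ,\|B_\star-\widehat B\|_\circ\}$ for $\circ\in\{\mathrm{op},F\}$,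 and $\alpha=8\|P_\star\|_{\mathrm{op}}^2\,\epsilon_{\mathrm{op}}$. If $\alpha<1$, then $(\widehat A,\widehat B)$ is stabilizable (and its Riccati equation has a unique positive semidefinite solution), $$\|P_\infty(\widehat A,\widehat B)\|_{\mathrm{op}}\le(1-\alpha)^{-1/2}\|P_\star\|_{\mathrm{op}},$$ and for both $\circ\in\{\mathrm{op},F\}$ $$\|K_\infty(\widehat A,\widehat B)-K_\star\|_\circ\le7(1-\alpha)^{-7/4}\|P_\star\|_{\mathrm{op}}^{7/2}\,\epsilon_\circ,$$ $$\|R_u^{1/2}(K_\infty(\widehat A,\widehat B)-K_\star)\|_\circ\le7(1-\alpha)^{-7/4}\|P_\star\|_{\mathrm{op}}^{7/2}\,\epsilon_\circ,$$ $$\|B_\star(K_\infty(\widehat A,\widehat B)-K_\star)\|_\circ\le8(1-\alpha)^{-7/4}\|P_\star\|_{\mathrm{op}}^{7/2}\,\epsilon_\circ.$$ In addition, if $\epsilon_{\mathrm{op}}\le32\|P_\star\|_{\mathrm{op}}^3$ (which $\alpha<1$ already implies), then for both $\circ\in\{\mathrm{op},F\}$ $$\|P_\star^{1/2}B_\star(K_\infty(\widehat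 A,\widehat B)-K_\star)\|_\circ\le9(1-\alpha)^{-7/4}\|P_\star\|_{\mathrm{op}}^{7/2}\,\epsilon_\circ.$$ -/

import Mathlib

open scoped Matrix

namespace LQR

noncomputable section

/-- The two matrix norms of interest: the spectral (operator) norm and the Frobenius norm. -/
inductive NormKind where
  | op
  | frob

section
open scoped Matrix.Norms.L2Operator

/-- The spectral norm: the operator norm of `X` between Euclidean spaces. -/
def opNorm {m n : ℕ} (X : Matrix (Fin m) (Fin n) ℝ) : ℝ := ‖X‖

end

section
open scoped Matrix.Norms.Frobenius

/-- The Frobenius norm: the square root of the sum of the squared entries. -/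
def frobNorm {m n : ℕ} (X : Matrix (Fin m) (Fin n) ℝ) : ℝ := ‖X‖

end

def matNorm (c : NormKind) {m n : ℕ} (X : Matrix (Fin m) (Fin n) ℝ) : ℝ :=
  match c with
  | .op => opNorm X
  | .frob => frobNorm X

section
open scoped Matrix.Norms.L2Operator MatrixOrder

/-- The positive semidefinite square root of a positive semidefinite matrix. -/
def psdSqrt {n : ℕ} (X : Matrix (Fin n) (Fin n) ℝ) : Matrix (Fin n) (Fin n) ℝ := CFC.sqrt X

theorem psdSqrt_spec {n : ℕ} {X : Matrix (Fin n) (Fin n) ℝ} (hX : X.PosSemidef) :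
    (psdSqrt X).PosSemidef ∧ psdSqrt X * psdSqrt X = X :=
  ⟨Matrix.nonneg_iff_posSemidef.mp (CFC.sqrt_nonneg X),
    CFC.sqrt_mul_sqrt_self X (Matrix.nonneg_iff_posSemidef.mpr hX)⟩

end

/-- `ρ(X) < 1`, where `ρ(X)` is the largest modulus of a complex eigenvalue of the real
matrix `X`. -/
def IsStable {n : ℕ} (X : Matrix (Fin n) (Fin n) ℝ) : Prop :=
  spectralRadius ℂ (X.map (algebraMap ℝ ℂ)) < 1

/-- `(A, B)` is stabilizable: some linear state feedback `u = K x` makes `A + B K` stable. -/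
def IsStabilizable {n m : ℕ} (A : Matrix (Fin n) (Fin n) ℝ) (B : Matrix (Fin n) (Fin m) ℝ) :
    Prop :=
  ∃ K : Matrix (Fin m) (Fin n) ℝ, IsStable (A + B * K)

/-- `P` is a positive semidefinite solution of the discrete algebraic Riccati equation with
state cost `Rx` and input cost `Ru`. -/
def IsDARESolution {n m : ℕ} (Rx : Matrix (Fin n) (Fin n) ℝ) (Ru : Matrix (Fin m) (Fin m) ℝ)
    (A : Matrix (Fin n) (Fin n) ℝ) (B : Matrix (Fin n) (Fin m) ℝ)
    (P : Matrix (Fin n) (Fin n) ℝ) : Prop :=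
  P.PosSemidef ∧
    P = Aᵀ * P * A - Aᵀ * P * B * (Ru + Bᵀ * P * B)⁻¹ * Bᵀ * P * A + Rx

open Classical in
/-- `P_∞(A, B)`: the positive semidefinite solution of the Riccati equation. It exists and is
unique when `(A, B)` is stabilizable and `Rx`, `Ru` are positive definite; if there is no
solution, the value is the placeholder `0`. -/
def PInf {n m : ℕ} (Rx : Matrix (Fin n) (Fin n) ℝ) (Ru : Matrix (Fin m) (Fin m) ℝ)
    (A : Matrix (Fin n) (Fin n) ℝ) (B : Matrix (Fin n) (Fin m) ℝ) : Matrix (Fin n) (Fin n) ℝ :=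
  if h : ∃ P, IsDARESolution Rx Ru A B P then h.choose else 0

/-- The optimal infinite-horizon controller
`K_∞(A, B) = -(Ru + Bᵀ P_∞(A, B) B)⁻¹ Bᵀ P_∞(A, B) A`. -/
def KInf {n m : ℕ} (Rx : Matrix (Fin n) (Fin n) ℝ) (Ru : Matrix (Fin m) (Fin m) ℝ)
    (A : Matrix (Fin n) (Fin n) ℝ) (B : Matrix (Fin n) (Fin m) ℝ) : Matrix (Fin m) (Fin n) ℝ :=
  -((Ru + Bᵀ * PInf Rx Ru A B * B)⁻¹ * Bᵀ * PInf Rx Ru A B * A)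

/-- `ε_∘ = max {‖A - A'‖_∘, ‖B - B'‖_∘}`. -/
def sysDist (c : NormKind) {n m : ℕ} (A : Matrix (Fin n) (Fin n) ℝ) (B : Matrix (Fin n) (Fin m) ℝ)
    (A' : Matrix (Fin n) (Fin n) ℝ) (B' : Matrix (Fin n) (Fin m) ℝ) : ℝ :=
  max (matNorm c (A - A')) (matNorm c (B - B'))

end

end LQR

/-!
A feedback `K` with running cost `S ≥ 1` stabilizes `(A, B)` as soon as some `X ≥ 0` satisfies
`(A + B K)ᵀ X (A + B K) + S ≤ X`; by minimality of the greedy feedback, such an `X` also dominates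
the Riccati solution. The optimal feedback of `(A, B)` applied to `(A', B')` has the certificate
`(1 - α / 2)⁻¹ P`, which gives stabilizability and the bound on `P'`.

With `M`, `M'` the optimal closed loops and `D`, `D'` their errors under exchange of the systems,
`P' - P = M'ᵀ (P' - P) M + M'ᵀ P' D + D'ᵀ P M` exactly. In the coordinates `P^{1/2} x` and
`P'^{1/2} x` the maps `M` and `M'` contract by `√(1 - ‖P‖⁻¹)` and `√(1 - ‖P'‖⁻¹)`, so this Stein
equation has gap at least `(‖P‖ ‖P'‖)^{-1/2}`; working in these coordinates rather than in
operator norm is what saves powers of `‖P‖`. The difference of the feedbacks is estimated after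
multiplication by `(Ru + B'ᵀ P' B')^{1/2}`, which dominates `1`, `Ru^{1/2}` and `B'` at once.
-/

namespace LQR

open Filter Topology
open scoped MatrixOrder Matrix.Norms.L2Operator

section Order

variable {ι κ : Type*}

lemma transpose_eq_of_nonneg {X : Matrix ι ι ℝ} (hX : 0 ≤ X) : Xᵀ = X := by
  rw [← Matrix.conjTranspose_eq_transpose_of_trivial]
  exact (Matrix.nonneg_iff_posSemidef.mp hX).isHermitian

instance instOrderClosedTopologyMatrix [Finite ι] : OrderClosedTopology (Matrix ι ι ℝ) where
  isClosed_le' := by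
    have := Fintype.ofFinite ι
    have : {p : Matrix ι ι ℝ × Matrix ι ι ℝ | p.1 ≤ p.2} =
        {p | (p.2 - p.1)ᵀ = p.2 - p.1} ∩
          ⋂ v : ι → ℝ, {p | 0 ≤ v ⬝ᵥ ((p.2 - p.1) *ᵥ v)} := by
      ext p
      simp only [Set.mem_ofPred_eq, Matrix.le_iff, Matrix.posSemidef_iff_dotProduct_mulVec,
        Matrix.IsHermitian, Matrix.conjTranspose_eq_transpose_of_trivial, star_trivial,
        Set.mem_inter_iff, Set.mem_iInter]
    rw [this]
    refine (isClosed_eq ?_ ?_).inter (isClosed_iInter fun v => isClosed_le ?_ ?_) <;> fun_prop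

variable [Fintype ι]

lemma transpose_mul_mul_mono [Finite κ] {X Y : Matrix ι ι ℝ} (h : X ≤ Y) (Z : Matrix ι κ ℝ) :
    Zᵀ * X * Z ≤ Zᵀ * Y * Z := by
  rw [Matrix.le_iff] at h ⊢
  simpa only [Matrix.conjTranspose_eq_transpose_of_trivial, Matrix.mul_sub, Matrix.sub_mul]
    using h.conjTranspose_mul_mul_same Z

lemma transpose_mul_mul_nonneg [Finite κ] {X : Matrix ι ι ℝ} (hX : 0 ≤ X) (Z : Matrix ι κ ℝ) :
    0 ≤ Zᵀ * X * Z := by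
  simpa using transpose_mul_mul_mono hX Z

lemma transpose_mul_self_nonneg [Finite κ] (X : Matrix ι κ ℝ) : 0 ≤ Xᵀ * X := by
  classical simpa using transpose_mul_mul_nonneg (zero_le_one (α := Matrix ι ι ℝ)) X

lemma trace_mono {X Y : Matrix ι ι ℝ} (h : X ≤ Y) : X.trace ≤ Y.trace :=
  OrderHomClass.mono (Matrix.tracePositiveLinearMap ι ℝ ℝ) h

variable [DecidableEq ι]

lemma isUnit_det_of_one_le {X : Matrix ι ι ℝ} (hX : 1 ≤ X) : IsUnit X.det := by
  have : (1 + (X - 1)).PosDef := Matrix.PosDef.one.add_posSemidef (Matrix.le_iff.mp hX)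
  rw [add_sub_cancel] at this
  exact (Matrix.isUnit_iff_isUnit_det _).mp this.isUnit

lemma le_norm_smul_one {X : Matrix ι ι ℝ} (hX : IsSelfAdjoint X) : X ≤ ‖X‖ • 1 := by
  rw [← Algebra.algebraMap_eq_smul_one, le_algebraMap_iff_spectrum_le]
  intro x hx
  refine (Real.le_norm_self x).trans ?_
  simpa only [cfc_id ℝ X, id] using norm_apply_le_norm_cfc (id : ℝ → ℝ) X hx

lemma norm_le_of_nonneg_of_le_smul_one {X : Matrix ι ι ℝ} (hX : 0 ≤ X) {c : ℝ} (hc : 0 ≤ c)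
    (h : X ≤ c • 1) : ‖X‖ ≤ c := by
  rw [← Algebra.algebraMap_eq_smul_one, le_algebraMap_iff_spectrum_le] at h
  rw [← cfc_id ℝ X]
  refine norm_cfc_le hc fun x hx => ?_
  simpa only [id, Real.norm_of_nonneg (spectrum_nonneg_of_nonneg hX hx)] using h x hx

lemma norm_le_norm_of_nonneg_of_le {X Y : Matrix ι ι ℝ} (hX : 0 ≤ X) (h : X ≤ Y) :
    ‖X‖ ≤ ‖Y‖ :=
  norm_le_of_nonneg_of_le_smul_one hX (norm_nonneg Y)
    (h.trans (le_norm_smul_one (.of_nonneg (hX.trans h))))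

lemma isCompact_Icc_matrix {ι : Type*} [Finite ι] (X Y : Matrix ι ι ℝ) :
    IsCompact (Set.Icc X Y) := by
  classical
  have := Fintype.ofFinite ι
  refine Metric.isCompact_of_isClosed_isBounded isClosed_Icc ?_
  refine (Metric.isBounded_iff_subset_closedBall X).mpr ⟨‖Y - X‖, fun Z hZ => ?_⟩
  rw [mem_closedBall_iff_norm]
  exact norm_le_norm_of_nonneg_of_le (sub_nonneg.mpr hZ.1) (sub_le_sub_right hZ.2 X)

variable [Fintype κ]

lemma norm_transpose_mul_self (X : Matrix κ ι ℝ) : ‖Xᵀ * X‖ = ‖X‖ ^ 2 := by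
  rw [← Matrix.conjTranspose_eq_transpose_of_trivial, Matrix.l2_opNorm_conjTranspose_mul_self, sq]

lemma transpose_mul_self_le (X : Matrix κ ι ℝ) : Xᵀ * X ≤ ‖X‖ ^ 2 • 1 := by
  simpa only [norm_transpose_mul_self]
    using le_norm_smul_one (IsSelfAdjoint.of_nonneg (transpose_mul_self_nonneg X))

lemma norm_le_of_transpose_mul_self_le {X : Matrix κ ι ℝ} {c : ℝ} (hc : 0 ≤ c)
    (h : Xᵀ * X ≤ c ^ 2 • 1) : ‖X‖ ≤ c := by
  refine le_of_sq_le_sq ?_ hc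
  rw [← norm_transpose_mul_self]
  exact norm_le_of_nonneg_of_le_smul_one (transpose_mul_self_nonneg X) (sq_nonneg c) h

lemma norm_transpose [DecidableEq κ] (X : Matrix κ ι ℝ) : ‖Xᵀ‖ = ‖X‖ := by
  rw [← Matrix.conjTranspose_eq_transpose_of_trivial, Matrix.l2_opNorm_conjTranspose]

lemma add_transpose_mul_add_le (X Y : Matrix κ ι ℝ) :
    (X + Y)ᵀ * (X + Y) ≤ Xᵀ * X + (2 * ‖X‖ * ‖Y‖ + ‖Y‖ ^ 2) • 1 := by
  classical
  have hself : IsSelfAdjoint (Xᵀ * Y + Yᵀ * X + Yᵀ * Y) := by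
    rw [IsSelfAdjoint, Matrix.star_eq_conjTranspose, Matrix.conjTranspose_eq_transpose_of_trivial]
    simp only [Matrix.transpose_add, Matrix.transpose_mul, Matrix.transpose_transpose]
    abel
  have hnorm : ‖Xᵀ * Y + Yᵀ * X + Yᵀ * Y‖ ≤ 2 * ‖X‖ * ‖Y‖ + ‖Y‖ ^ 2 := by
    have hXY := Matrix.l2_opNorm_mul Xᵀ Y
    have hYX := Matrix.l2_opNorm_mul Yᵀ X
    rw [norm_transpose] at hXY hYX
    have hsum := norm_add₃_le (a := Xᵀ * Y) (b := Yᵀ * X) (c := Yᵀ * Y)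
    rw [norm_transpose_mul_self] at hsum
    linarith
  calc (X + Y)ᵀ * (X + Y) = Xᵀ * X + (Xᵀ * Y + Yᵀ * X + Yᵀ * Y) := by
        rw [Matrix.transpose_add, Matrix.add_mul, Matrix.mul_add, Matrix.mul_add]; abel
    _ ≤ Xᵀ * X + (2 * ‖X‖ * ‖Y‖ + ‖Y‖ ^ 2) • 1 := by
        gcongr
        exact (le_norm_smul_one hself).trans (smul_le_smul_of_nonneg_right hnorm zero_le_one)

lemma one_le_norm [Nonempty ι] {X : Matrix ι ι ℝ} (hX : 1 ≤ X) : 1 ≤ ‖X‖ := by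
  simpa only [norm_one] using norm_le_norm_of_nonneg_of_le (zero_le_one' (Matrix ι ι ℝ)) hX

end Order

section Stability

theorem spectralRadius_lt_one_iff_tendsto_pow {𝓐 : Type*} [NormedRing 𝓐] [NormedAlgebra ℂ 𝓐]
    [CompleteSpace 𝓐] (a : 𝓐) :
    spectralRadius ℂ a < 1 ↔ Tendsto (fun k : ℕ => a ^ k) atTop (𝓝 0) := by
  constructor <;> intro h
  · obtain ⟨r, har, hr⟩ := ENNReal.lt_iff_exists_nnreal_btwn.mp h
    have hr : (r : ℝ) < 1 := by exact_mod_cast hr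
    refine squeeze_zero_norm' ?_ (tendsto_pow_atTop_nhds_zero_of_lt_one r.coe_nonneg hr)
    filter_upwards [(spectrum.pow_nnnorm_pow_one_div_tendsto_nhds_spectralRadius
      a).eventually_lt_const har, eventually_gt_atTop 0] with k hk hk0
    rw [one_div, ENNReal.rpow_inv_lt_iff (by exact_mod_cast hk0), ENNReal.rpow_natCast] at hk
    exact_mod_cast hk.le
  · have hmul : Tendsto (fun k : ℕ => ‖a ^ k‖₊ * ‖(1 : 𝓐)‖₊) atTop (𝓝 0) := by
      simpa using h.nnnorm.mul_const ‖(1 : 𝓐)‖₊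
    obtain ⟨k, hk, hk0⟩ :=
      ((hmul.eventually_lt_const one_pos).and (eventually_ne_atTop 0)).exists
    have hle : spectralRadius ℂ (a ^ k) ≤ (‖a ^ k‖₊ * ‖(1 : 𝓐)‖₊ : NNReal) :=
      iSup₂_le fun z hz => by exact_mod_cast spectrum.norm_le_norm_mul_of_mem hz
    rw [← pow_lt_one_iff hk0]
    exact ((spectrum.spectralRadius_pow_le a k hk0).trans hle).trans_lt (by exact_mod_cast hk)

theorem isStable_iff_tendsto_pow {n : ℕ} (M : Matrix (Fin n) (Fin n) ℝ) :
    IsStable M ↔ Tendsto (fun k : ℕ => M ^ k) atTop (𝓝 0) := by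
  have hmap (k : ℕ) : M.map (algebraMap ℝ ℂ) ^ k = (M ^ k).map (algebraMap ℝ ℂ) :=
    ((algebraMap ℝ ℂ).mapMatrix.map_pow M k).symm
  have hentry (X : ℕ → Matrix (Fin n) (Fin n) ℝ) :
      Tendsto (fun k => (X k).map (algebraMap ℝ ℂ)) atTop (𝓝 0) ↔ Tendsto X atTop (𝓝 0) := by
    refine tendsto_pi_nhds.trans (.trans (forall_congr' fun i => ?_) tendsto_pi_nhds.symm)
    refine tendsto_pi_nhds.trans (.trans (forall_congr' fun j => ?_) tendsto_pi_nhds.symm)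
    exact Filter.tendsto_ofReal_iff (x := 0)
  rw [IsStable, spectralRadius_lt_one_iff_tendsto_pow]
  simp_rw [hmap]
  exact hentry _

end Stability

section Lyapunov

variable {ι : Type*} [Fintype ι]

/-- `X` is a Lyapunov certificate for the linear dynamics `M` with running cost `S`: a positive
semidefinite supersolution of the Lyapunov equation `Mᵀ X M + S = X`. -/
structure IsLyapunovCertificate (M S X : Matrix ι ι ℝ) : Prop where
  nonneg : 0 ≤ X
  le : Mᵀ * X * M + S ≤ X

namespace IsLyapunovCertificate

variable [DecidableEq ι] {M S X Y : Matrix ι ι ℝ}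

lemma one_le (h : IsLyapunovCertificate M S X) (hS : 1 ≤ S) : 1 ≤ X :=
  hS.trans ((le_add_of_nonneg_left (transpose_mul_mul_nonneg h.nonneg M)).trans h.le)

lemma exists_contraction (h : IsLyapunovCertificate M S X) (hS : 1 ≤ S) :
    ∃ q : ℝ, 0 ≤ q ∧ q < 1 ∧ Mᵀ * X * M ≤ q • X := by
  have hpos : 0 < ‖X‖ + 1 := by positivity
  have hXS : (‖X‖ + 1)⁻¹ • X ≤ S := by
    refine le_trans ?_ hS
    rw [inv_smul_le_iff_of_pos hpos]
    exact (le_norm_smul_one (.of_nonneg h.nonneg)).trans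
      (smul_le_smul_of_nonneg_right (by linarith) zero_le_one)
  refine ⟨1 - (‖X‖ + 1)⁻¹, ?_, by linarith [inv_pos.mpr hpos], ?_⟩
  · exact sub_nonneg.mpr (inv_le_one_of_one_le₀ (by linarith [norm_nonneg X]))
  · rw [sub_smul, one_smul, le_sub_iff_add_le]
    exact (add_le_add_right hXS _).trans h.le

lemma transpose_pow_mul_mul_pow_le {q : ℝ} (hq : 0 ≤ q) (h : Mᵀ * X * M ≤ q • X) (k : ℕ) :
    (M ^ k)ᵀ * X * M ^ k ≤ q ^ k • X := by
  induction k with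
  | zero => simp
  | succ k ih =>
    calc (M ^ (k + 1))ᵀ * X * M ^ (k + 1) = Mᵀ * ((M ^ k)ᵀ * X * M ^ k) * M := by
          simp only [pow_succ, Matrix.transpose_mul, Matrix.mul_assoc]
      _ ≤ Mᵀ * (q ^ k • X) * M := transpose_mul_mul_mono ih M
      _ = q ^ k • (Mᵀ * X * M) := by rw [Matrix.mul_smul, Matrix.smul_mul]
      _ ≤ q ^ k • (q • X) := smul_le_smul_of_nonneg_left h (pow_nonneg hq k)
      _ = q ^ (k + 1) • X := by rw [smul_smul, pow_succ]

lemma tendsto_pow (h : IsLyapunovCertificate M S X) (hS : 1 ≤ S) :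
    Tendsto (fun k : ℕ => M ^ k) atTop (𝓝 0) := by
  obtain ⟨q, hq0, hq1, hq⟩ := h.exists_contraction hS
  have hbound (k : ℕ) : ‖M ^ k‖ ^ 2 ≤ q ^ k * ‖X‖ := by
    rw [← norm_transpose_mul_self, ← Real.norm_of_nonneg (pow_nonneg hq0 k), ← norm_smul]
    refine norm_le_norm_of_nonneg_of_le (transpose_mul_self_nonneg _)
      (le_trans ?_ (transpose_pow_mul_mul_pow_le hq0 hq k))
    simpa using transpose_mul_mul_mono (h.one_le hS) (M ^ k)
  have hsq : Tendsto (fun k : ℕ => ‖M ^ k‖ ^ 2) atTop (𝓝 0) :=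
    squeeze_zero (fun k => sq_nonneg _) hbound
      (by simpa using (tendsto_pow_atTop_nhds_zero_of_lt_one hq0 hq1).mul_const ‖X‖)
  exact tendsto_zero_iff_norm_tendsto_zero.mpr (by simpa using hsq.sqrt)

lemma le_of_subsolution (h : IsLyapunovCertificate M S X) (hS : 1 ≤ S)
    (hYsa : IsSelfAdjoint Y) (hY : Y ≤ Mᵀ * Y * M + S) : Y ≤ X := by
  obtain ⟨q, hq0, hq1, hq⟩ := h.exists_contraction hS
  have hstep : Y - X ≤ Mᵀ * (Y - X) * M := by
    simpa only [add_sub_add_right_eq_sub, ← Matrix.mul_sub, ← Matrix.sub_mul]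
      using sub_le_sub hY h.le
  have hdecay (k : ℕ) : Y - X ≤ (‖Y - X‖ * q ^ k) • X := by
    induction k with
    | zero =>
      simpa using (le_norm_smul_one (hYsa.sub (.of_nonneg h.nonneg))).trans
        (smul_le_smul_of_nonneg_left (h.one_le hS) (norm_nonneg _))
    | succ k ih =>
      calc Y - X ≤ Mᵀ * (Y - X) * M := hstep
        _ ≤ Mᵀ * ((‖Y - X‖ * q ^ k) • X) * M := transpose_mul_mul_mono ih M
        _ = (‖Y - X‖ * q ^ k) • (Mᵀ * X * M) := by rw [Matrix.mul_smul, Matrix.smul_mul]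
        _ ≤ (‖Y - X‖ * q ^ k) • (q • X) := smul_le_smul_of_nonneg_left hq (by positivity)
        _ = (‖Y - X‖ * q ^ (k + 1)) • X := by rw [smul_smul, pow_succ, mul_assoc]
  have hlim : Tendsto (fun k : ℕ => (‖Y - X‖ * q ^ k) • X) atTop (𝓝 0) := by
    simpa using ((tendsto_pow_atTop_nhds_zero_of_lt_one hq0 hq1).const_mul ‖Y - X‖).smul_const X
  exact sub_nonpos.mp (ge_of_tendsto' hlim hdecay)

lemma inv_smul_of_perturbed {N : Matrix ι ι ℝ} {δ : ℝ} (h : IsLyapunovCertificate M S X)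
    (hS : 1 ≤ S) (hδ0 : 0 ≤ δ) (hδ1 : δ < 1) (hN : Nᵀ * X * N ≤ Mᵀ * X * M + δ • 1) :
    IsLyapunovCertificate N S ((1 - δ)⁻¹ • X) := by
  have hpos : 0 < 1 - δ := sub_pos.mpr hδ1
  refine ⟨smul_nonneg (inv_nonneg.mpr hpos.le) h.nonneg, ?_⟩
  rw [Matrix.mul_smul, Matrix.smul_mul, ← inv_smul_smul₀ hpos.ne' S, ← smul_add]
  refine smul_le_smul_of_nonneg_left ?_ (inv_nonneg.mpr hpos.le)
  calc Nᵀ * X * N + (1 - δ) • S ≤ Mᵀ * X * M + δ • S + (1 - δ) • S := by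
        gcongr
        exact hN.trans (by gcongr)
    _ = Mᵀ * X * M + S := by module
    _ ≤ X := h.le

lemma isStable {n : ℕ} {M S X : Matrix (Fin n) (Fin n) ℝ} (h : IsLyapunovCertificate M S X)
    (hS : 1 ≤ S) : IsStable M :=
  (isStable_iff_tendsto_pow M).mpr (h.tendsto_pow hS)

end IsLyapunovCertificate

lemma exists_transpose_pow_mul_mul_pow_le [DecidableEq ι] {M S : Matrix ι ι ℝ} (hS : 1 ≤ S)
    (hM : Tendsto (fun k : ℕ => M ^ k) atTop (𝓝 0)) {q : ℝ} (hq : 0 < q) :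
    ∃ k : ℕ, (M ^ k)ᵀ * S * M ^ k ≤ q • S := by
  have hcont : Continuous fun Z : Matrix ι ι ℝ => ‖Zᵀ * S * Z‖ := by fun_prop
  have hlim : Tendsto (fun k : ℕ => ‖(M ^ k)ᵀ * S * M ^ k‖) atTop (𝓝 0) := by
    simpa only [Function.comp_def, Matrix.mul_zero, norm_zero] using (hcont.tendsto 0).comp hM
  obtain ⟨k, hk⟩ := (hlim.eventually_lt_const hq).exists
  refine ⟨k, ?_⟩
  calc (M ^ k)ᵀ * S * M ^ k ≤ ‖(M ^ k)ᵀ * S * M ^ k‖ • 1 :=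
        le_norm_smul_one (.of_nonneg (transpose_mul_mul_nonneg (zero_le_one.trans hS) _))
    _ ≤ q • 1 := smul_le_smul_of_nonneg_right hk.le zero_le_one
    _ ≤ q • S := smul_le_smul_of_nonneg_left hS hq.le

-- If the `k`-th power of the dynamics halves the cost, twice the `k`-step cost is a supersolution.
theorem exists_isLyapunovCertificate [DecidableEq ι] {M S : Matrix ι ι ℝ} (hS : 1 ≤ S)
    (hM : Tendsto (fun k : ℕ => M ^ k) atTop (𝓝 0)) : ∃ X, IsLyapunovCertificate M S X := by
  obtain ⟨k, hk⟩ := exists_transpose_pow_mul_mul_pow_le hS hM one_half_pos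
  set Y := ∑ j ∈ Finset.range k, (M ^ j)ᵀ * S * M ^ j
  have hY : 0 ≤ Y := Finset.sum_nonneg fun j _ =>
    transpose_mul_mul_nonneg (zero_le_one.trans hS) (M ^ j)
  have hYM : Mᵀ * Y * M + S = Y + (M ^ k)ᵀ * S * M ^ k := by
    rw [← Finset.sum_range_succ, Finset.sum_range_succ', Matrix.mul_sum, Matrix.sum_mul]
    simp [pow_succ, Matrix.transpose_mul, Matrix.mul_assoc]
  refine ⟨(2 : ℝ) • Y, smul_nonneg zero_le_two hY, ?_⟩
  have hhalf : Mᵀ * Y * M + S ≤ Y + (1 / 2 : ℝ) • S := hYM.trans_le (add_le_add_right hk Y)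
  calc Mᵀ * ((2 : ℝ) • Y) * M + S = (2 : ℝ) • (Mᵀ * Y * M + S) - S := by
        rw [Matrix.mul_smul, Matrix.smul_mul]; module
    _ ≤ (2 : ℝ) • (Y + (1 / 2 : ℝ) • S) - S :=
        sub_le_sub_right (smul_le_smul_of_nonneg_left hhalf zero_le_two) S
    _ = (2 : ℝ) • Y := by module

end Lyapunov

section Riccati

variable {m n : ℕ}

/-- The running cost `x ↦ xᵀ (Rx + Kᵀ Ru K) x` of the feedback `u = K x`. -/
def stageCost (Rx : Matrix (Fin n) (Fin n) ℝ) (Ru : Matrix (Fin m) (Fin m) ℝ)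
    (K : Matrix (Fin m) (Fin n) ℝ) : Matrix (Fin n) (Fin n) ℝ :=
  Rx + Kᵀ * Ru * K

/-- The Bellman operator of the fixed feedback `u = K x`: one step of running cost followed by the
terminal cost `P`. -/
def policyOp (Rx : Matrix (Fin n) (Fin n) ℝ) (Ru : Matrix (Fin m) (Fin m) ℝ)
    (A : Matrix (Fin n) (Fin n) ℝ) (B : Matrix (Fin n) (Fin m) ℝ) (K : Matrix (Fin m) (Fin n) ℝ)
    (P : Matrix (Fin n) (Fin n) ℝ) : Matrix (Fin n) (Fin n) ℝ :=
  (A + B * K)ᵀ * P * (A + B * K) + stageCost Rx Ru K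

/-- The Hessian `Ru + Bᵀ P B` of the one-step cost in the input `u`, for the terminal cost `P`. -/
def inputWeight (Ru : Matrix (Fin m) (Fin m) ℝ) (B : Matrix (Fin n) (Fin m) ℝ)
    (P : Matrix (Fin n) (Fin n) ℝ) : Matrix (Fin m) (Fin m) ℝ :=
  Ru + Bᵀ * P * B

/-- The feedback that is greedy for the terminal cost `P`, that is, minimizes the one-step cost. -/
noncomputable def gain (Ru : Matrix (Fin m) (Fin m) ℝ) (A : Matrix (Fin n) (Fin n) ℝ)
    (B : Matrix (Fin n) (Fin m) ℝ) (P : Matrix (Fin n) (Fin n) ℝ) : Matrix (Fin m) (Fin n) ℝ :=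
  -((inputWeight Ru B P)⁻¹ * Bᵀ * P * A)

lemma KInf_eq_gain (Rx : Matrix (Fin n) (Fin n) ℝ) (Ru : Matrix (Fin m) (Fin m) ℝ)
    (A : Matrix (Fin n) (Fin n) ℝ) (B : Matrix (Fin n) (Fin m) ℝ) :
    KInf Rx Ru A B = gain Ru A B (PInf Rx Ru A B) :=
  rfl

variable {Rx : Matrix (Fin n) (Fin n) ℝ} {Ru : Matrix (Fin m) (Fin m) ℝ}
  {A : Matrix (Fin n) (Fin n) ℝ} {B : Matrix (Fin n) (Fin m) ℝ} {P Q X : Matrix (Fin n) (Fin n) ℝ}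
  {K : Matrix (Fin m) (Fin n) ℝ}

lemma one_le_stageCost (hRx : 1 ≤ Rx) (hRu : 0 ≤ Ru) (K : Matrix (Fin m) (Fin n) ℝ) :
    1 ≤ stageCost Rx Ru K :=
  hRx.trans (le_add_of_nonneg_right (transpose_mul_mul_nonneg hRu K))

lemma le_inputWeight (hP : 0 ≤ P) (B : Matrix (Fin n) (Fin m) ℝ) : Ru ≤ inputWeight Ru B P :=
  le_add_of_nonneg_right (transpose_mul_mul_nonneg hP B)

lemma policyOp_mono (K : Matrix (Fin m) (Fin n) ℝ) (h : P ≤ Q) :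
    policyOp Rx Ru A B K P ≤ policyOp Rx Ru A B K Q :=
  add_le_add_left (transpose_mul_mul_mono h _) _

lemma inputWeight_mul_gain (hRu : 1 ≤ Ru) (hP : 0 ≤ P) :
    inputWeight Ru B P * gain Ru A B P = -(Bᵀ * P * A) := by
  rw [gain, Matrix.mul_neg, Matrix.mul_assoc _ Bᵀ P, Matrix.mul_assoc _ (Bᵀ * P) A,
    Matrix.mul_nonsing_inv_cancel_left _ _
      (isUnit_det_of_one_le (hRu.trans (le_inputWeight hP B)))]

lemma gain_stationary (hRu : 1 ≤ Ru) (hP : 0 ≤ P) :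
    Bᵀ * P * (A + B * gain Ru A B P) + Ru * gain Ru A B P = 0 := by
  have := inputWeight_mul_gain (A := A) (B := B) hRu hP
  rw [inputWeight, Matrix.add_mul, ← sub_eq_zero, sub_neg_eq_add] at this
  rw [← this, Matrix.mul_add, ← Matrix.mul_assoc]
  abel

/-- Since the greedy feedback is stationary, the mixed cost does not depend on `K`. -/
lemma mixed_policyOp_eq (hRu : 1 ≤ Ru) (hP : 0 ≤ P) (K : Matrix (Fin m) (Fin n) ℝ) :
    (A + B * K)ᵀ * P * (A + B * gain Ru A B P) + (Rx + Kᵀ * Ru * gain Ru A B P) =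
      Aᵀ * P * (A + B * gain Ru A B P) + Rx := by
  have := congrArg (Kᵀ * ·) (gain_stationary (A := A) (B := B) hRu hP)
  simp only [Matrix.mul_add Kᵀ, Matrix.mul_zero, ← Matrix.mul_assoc] at this
  rw [Matrix.transpose_add, Matrix.transpose_mul, Matrix.add_mul, Matrix.add_mul,
    ← sub_eq_zero, ← this]
  abel

lemma policyOp_eq_policyOp_gain_add (hRu : 1 ≤ Ru) (hP : 0 ≤ P) (K : Matrix (Fin m) (Fin n) ℝ) :
    policyOp Rx Ru A B K P = policyOp Rx Ru A B (gain Ru A B P) P +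
      (K - gain Ru A B P)ᵀ * inputWeight Ru B P * (K - gain Ru A B P) := by
  have hst := gain_stationary (A := A) (B := B) hRu hP
  generalize gain Ru A B P = G at *
  have hcross : (K - G)ᵀ * (Bᵀ * P * (A + B * G) + Ru * G) = 0 := by rw [hst, Matrix.mul_zero]
  rw [← add_zero (_ + _), ← hcross, ← add_zero (_ + _), ← Matrix.transpose_zero, ← hcross]
  simp only [policyOp, stageCost, inputWeight, Matrix.transpose_add, Matrix.transpose_mul,
    Matrix.transpose_sub, Matrix.transpose_transpose, transpose_eq_of_nonneg hP,
    transpose_eq_of_nonneg (zero_le_one.trans hRu), Matrix.mul_add, Matrix.add_mul,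
    Matrix.mul_sub, Matrix.sub_mul, Matrix.mul_assoc]
  abel

theorem policyOp_gain_le (hRu : 1 ≤ Ru) (hP : 0 ≤ P) (K : Matrix (Fin m) (Fin n) ℝ) :
    policyOp Rx Ru A B (gain Ru A B P) P ≤ policyOp Rx Ru A B K P := by
  rw [policyOp_eq_policyOp_gain_add hRu hP K]
  exact le_add_of_nonneg_right (transpose_mul_mul_nonneg
    (zero_le_one.trans (hRu.trans (le_inputWeight hP B))) _)

theorem isDARESolution_iff (hRu : 1 ≤ Ru) :
    IsDARESolution Rx Ru A B P ↔ 0 ≤ P ∧ policyOp Rx Ru A B (gain Ru A B P) P = P := by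
  rw [IsDARESolution, ← Matrix.nonneg_iff_posSemidef]
  refine and_congr_right fun hP => ?_
  rw [policyOp, stageCost, mixed_policyOp_eq hRu hP, gain, inputWeight, eq_comm, Matrix.mul_neg,
    Matrix.mul_add, Matrix.mul_neg, sub_eq_add_neg]
  simp only [Matrix.mul_assoc]

namespace IsDARESolution

lemma nonneg (h : IsDARESolution Rx Ru A B P) : 0 ≤ P :=
  Matrix.nonneg_iff_posSemidef.mpr h.1

lemma policyOp_gain_eq (h : IsDARESolution Rx Ru A B P) (hRu : 1 ≤ Ru) :
    policyOp Rx Ru A B (gain Ru A B P) P = P :=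
  ((isDARESolution_iff hRu).mp h).2

lemma isLyapunovCertificate (h : IsDARESolution Rx Ru A B P) (hRu : 1 ≤ Ru) :
    IsLyapunovCertificate (A + B * gain Ru A B P) (stageCost Rx Ru (gain Ru A B P)) P :=
  ⟨h.nonneg, (h.policyOp_gain_eq hRu).le⟩

lemma stageCost_le (h : IsDARESolution Rx Ru A B P) (hRu : 1 ≤ Ru) :
    stageCost Rx Ru (gain Ru A B P) ≤ P :=
  (le_add_of_nonneg_left (transpose_mul_mul_nonneg h.nonneg _)).trans
    (h.policyOp_gain_eq hRu).le

lemma one_le (h : IsDARESolution Rx Ru A B P) (hRx : 1 ≤ Rx) (hRu : 1 ≤ Ru) : 1 ≤ P :=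
  (one_le_stageCost hRx (zero_le_one.trans hRu) _).trans (h.stageCost_le hRu)

theorem le_of_isLyapunovCertificate (h : IsDARESolution Rx Ru A B P) (hRx : 1 ≤ Rx)
    (hRu : 1 ≤ Ru) (hX : IsLyapunovCertificate (A + B * K) (stageCost Rx Ru K) X) : P ≤ X :=
  hX.le_of_subsolution (one_le_stageCost hRx (zero_le_one.trans hRu) K) (.of_nonneg h.nonneg)
    ((h.policyOp_gain_eq hRu).ge.trans (policyOp_gain_le hRu h.nonneg K))

theorem unique (hP : IsDARESolution Rx Ru A B P) (hQ : IsDARESolution Rx Ru A B Q)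
    (hRx : 1 ≤ Rx) (hRu : 1 ≤ Ru) : P = Q :=
  le_antisymm (hP.le_of_isLyapunovCertificate hRx hRu (hQ.isLyapunovCertificate hRu))
    (hQ.le_of_isLyapunovCertificate hRx hRu (hP.isLyapunovCertificate hRu))

end IsDARESolution

namespace IsLyapunovCertificate

-- Among the `P` below the certificate that no feedback improves upon, one of maximal trace is
-- fixed by its greedy feedback, because that feedback maps the set into itself and increases `P`.
theorem exists_isDARESolution (hX : IsLyapunovCertificate (A + B * K) (stageCost Rx Ru K) X)
    (hRx : 0 ≤ Rx) (hRu : 1 ≤ Ru) : ∃ P, IsDARESolution Rx Ru A B P := by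
  set s : Set (Matrix (Fin n) (Fin n) ℝ) :=
    Set.Icc 0 X ∩ ⋂ L : Matrix (Fin m) (Fin n) ℝ, {P | P ≤ policyOp Rx Ru A B L P}
  have hs : IsCompact s := by
    refine (isCompact_Icc_matrix 0 X).inter_right (isClosed_iInter fun L => ?_)
    exact isClosed_le continuous_id (by unfold policyOp; fun_prop)
  have hs0 : (0 : Matrix (Fin n) (Fin n) ℝ) ∈ s := by
    refine ⟨⟨le_rfl, hX.nonneg⟩, Set.mem_iInter.mpr fun L => ?_⟩
    simpa [policyOp, stageCost] using
      add_nonneg hRx (transpose_mul_mul_nonneg (zero_le_one.trans hRu) L)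
  obtain ⟨P, ⟨⟨hP0, hPX⟩, hPL⟩, hmax⟩ := hs.exists_isMaxOn ⟨0, hs0⟩
    (f := Matrix.trace) (Continuous.continuousOn (by fun_prop))
  rw [Set.mem_iInter] at hPL
  set Q := policyOp Rx Ru A B (gain Ru A B P) P
  have hPQ : P ≤ Q := hPL _
  have hQs : Q ∈ s := by
    refine ⟨⟨hP0.trans hPQ, ?_⟩, Set.mem_iInter.mpr fun L => ?_⟩
    · exact (policyOp_gain_le hRu hP0 K).trans ((policyOp_mono K hPX).trans hX.le)
    · exact (policyOp_gain_le hRu hP0 L).trans (policyOp_mono L hPQ)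
  have hzero : Q - P = 0 := by
    refine (Matrix.le_iff.mp hPQ).trace_eq_zero_iff.mp ?_
    rw [Matrix.trace_sub]
    exact sub_eq_zero.mpr (le_antisymm (hmax hQs) (trace_mono hPQ))
  exact ⟨P, (isDARESolution_iff hRu).mpr ⟨hP0, sub_eq_zero.mp hzero⟩⟩

theorem existsUnique_isDARESolution
    (hX : IsLyapunovCertificate (A + B * K) (stageCost Rx Ru K) X)
    (hRx : 1 ≤ Rx) (hRu : 1 ≤ Ru) : ∃! P, IsDARESolution Rx Ru A B P := by
  obtain ⟨P, hP⟩ := hX.exists_isDARESolution (zero_le_one.trans hRx) hRu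
  exact ⟨P, hP, fun Q hQ => hQ.unique hP hRx hRu⟩

lemma isStabilizable (hX : IsLyapunovCertificate (A + B * K) (stageCost Rx Ru K) X)
    (hRx : 1 ≤ Rx) (hRu : 1 ≤ Ru) : IsStabilizable A B :=
  ⟨K, hX.isStable (one_le_stageCost hRx (zero_le_one.trans hRu) K)⟩

end IsLyapunovCertificate

theorem IsStabilizable.existsUnique_isDARESolution (h : IsStabilizable A B) (hRx : 1 ≤ Rx)
    (hRu : 1 ≤ Ru) : ∃! P, IsDARESolution Rx Ru A B P := by
  obtain ⟨K, hK⟩ := h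
  obtain ⟨X, hX⟩ := exists_isLyapunovCertificate
    (one_le_stageCost hRx (zero_le_one.trans hRu) K) ((isStable_iff_tendsto_pow _).mp hK)
  exact hX.existsUnique_isDARESolution hRx hRu

lemma isDARESolution_PInf (h : ∃ P, IsDARESolution Rx Ru A B P) :
    IsDARESolution Rx Ru A B (PInf Rx Ru A B) := by
  rw [PInf, dif_pos h]
  exact h.choose_spec

end Riccati

section MatrixNorm

variable {k l m n : ℕ}

section Frobenius

open scoped Matrix.Norms.Frobenius

lemma frobNorm_nonneg (X : Matrix (Fin m) (Fin n) ℝ) : 0 ≤ frobNorm X :=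
  norm_nonneg X

lemma frobNorm_zero : frobNorm (0 : Matrix (Fin m) (Fin n) ℝ) = 0 :=
  norm_zero

lemma frobNorm_neg (X : Matrix (Fin m) (Fin n) ℝ) : frobNorm (-X) = frobNorm X :=
  norm_neg X

lemma frobNorm_add_le (X Y : Matrix (Fin m) (Fin n) ℝ) :
    frobNorm (X + Y) ≤ frobNorm X + frobNorm Y :=
  norm_add_le X Y

lemma frobNorm_transpose (X : Matrix (Fin m) (Fin n) ℝ) : frobNorm Xᵀ = frobNorm X :=
  Matrix.frobenius_norm_transpose X

lemma frobNorm_sq (X : Matrix (Fin m) (Fin n) ℝ) : frobNorm X ^ 2 = (Xᵀ * X).trace := by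
  rw [frobNorm, Matrix.frobenius_norm_def, ← Real.sqrt_eq_rpow, Real.sq_sqrt (by positivity),
    Finset.sum_comm]
  simp only [Matrix.trace, Matrix.diag, Matrix.mul_apply, Matrix.transpose_apply, ← sq,
    Real.rpow_ofNat, Real.norm_eq_abs, sq_abs]

end Frobenius

lemma frobNorm_mul_le (X : Matrix (Fin l) (Fin m) ℝ) (Y : Matrix (Fin m) (Fin n) ℝ) :
    frobNorm (X * Y) ≤ ‖X‖ * frobNorm Y := by
  refine le_of_sq_le_sq ?_ (mul_nonneg (norm_nonneg X) (frobNorm_nonneg Y))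
  calc frobNorm (X * Y) ^ 2 = (Yᵀ * (Xᵀ * X) * Y).trace := by
        rw [frobNorm_sq, Matrix.transpose_mul]; simp only [Matrix.mul_assoc]
    _ ≤ (Yᵀ * (‖X‖ ^ 2 • (1 : Matrix (Fin m) (Fin m) ℝ)) * Y).trace :=
        trace_mono (transpose_mul_mul_mono (transpose_mul_self_le X) Y)
    _ = (‖X‖ * frobNorm Y) ^ 2 := by
        rw [Matrix.mul_smul, Matrix.smul_mul, Matrix.mul_one, Matrix.trace_smul, ← frobNorm_sq,
          smul_eq_mul, mul_pow]

lemma matNorm_nonneg (c : NormKind) (X : Matrix (Fin m) (Fin n) ℝ) : 0 ≤ matNorm c X := by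
  cases c
  exacts [norm_nonneg X, frobNorm_nonneg X]

lemma matNorm_eq_zero_of_isEmpty [IsEmpty (Fin n)] (c : NormKind) (X : Matrix (Fin m) (Fin n) ℝ) :
    matNorm c X = 0 := by
  rw [Subsingleton.elim X 0]
  cases c
  · exact norm_zero
  · exact frobNorm_zero

lemma matNorm_neg (c : NormKind) (X : Matrix (Fin m) (Fin n) ℝ) :
    matNorm c (-X) = matNorm c X := by
  cases c
  exacts [norm_neg X, frobNorm_neg X]

lemma matNorm_add_le (c : NormKind) (X Y : Matrix (Fin m) (Fin n) ℝ) :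
    matNorm c (X + Y) ≤ matNorm c X + matNorm c Y := by
  cases c
  exacts [norm_add_le X Y, frobNorm_add_le X Y]

lemma matNorm_transpose (c : NormKind) (X : Matrix (Fin m) (Fin n) ℝ) :
    matNorm c Xᵀ = matNorm c X := by
  cases c
  exacts [norm_transpose X, frobNorm_transpose X]

lemma matNorm_mul_le_left (c : NormKind) (X : Matrix (Fin l) (Fin m) ℝ)
    (Y : Matrix (Fin m) (Fin n) ℝ) : matNorm c (X * Y) ≤ ‖X‖ * matNorm c Y := by
  cases c
  exacts [Matrix.l2_opNorm_mul X Y, frobNorm_mul_le X Y]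

lemma matNorm_mul_le_right (c : NormKind) (X : Matrix (Fin l) (Fin m) ℝ)
    (Y : Matrix (Fin m) (Fin n) ℝ) : matNorm c (X * Y) ≤ matNorm c X * ‖Y‖ := by
  rw [← matNorm_transpose, Matrix.transpose_mul, ← matNorm_transpose c X, ← norm_transpose Y,
    mul_comm]
  exact matNorm_mul_le_left c Yᵀ Xᵀ

variable {c : NormKind} {X : Matrix (Fin l) (Fin m) ℝ} {Y : Matrix (Fin m) (Fin n) ℝ} {a b : ℝ}

lemma matNorm_mul_le_of_le_left (hX : ‖X‖ ≤ a) (hY : matNorm c Y ≤ b) :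
    matNorm c (X * Y) ≤ a * b :=
  (matNorm_mul_le_left c X Y).trans
    (mul_le_mul hX hY (matNorm_nonneg c Y) ((norm_nonneg X).trans hX))

lemma matNorm_mul_le_of_le_right (hX : matNorm c X ≤ a) (hY : ‖Y‖ ≤ b) :
    matNorm c (X * Y) ≤ a * b :=
  (matNorm_mul_le_right c X Y).trans
    (mul_le_mul hX hY (norm_nonneg Y) ((matNorm_nonneg c X).trans hX))

lemma matNorm_le_of_eq_mul_mul_add {X : Matrix (Fin l) (Fin l) ℝ} {Y : Matrix (Fin m) (Fin m) ℝ}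
    {Z W : Matrix (Fin l) (Fin m) ℝ} (h : Z = X * Z * Y + W) :
    (1 - ‖X‖ * ‖Y‖) * matNorm c Z ≤ matNorm c W := by
  have hXZY : matNorm c (X * Z * Y) ≤ ‖X‖ * matNorm c Z * ‖Y‖ :=
    matNorm_mul_le_of_le_right (matNorm_mul_le_left c X Z) le_rfl
  have hZ : matNorm c Z ≤ matNorm c (X * Z * Y) + matNorm c W :=
    (congrArg (matNorm c) h).trans_le (matNorm_add_le c _ _)
  linarith

end MatrixNorm

section SquareRoot

variable {k l n : ℕ} {X : Matrix (Fin n) (Fin n) ℝ}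

lemma psdSqrt_nonneg (X : Matrix (Fin n) (Fin n) ℝ) : 0 ≤ psdSqrt X :=
  CFC.sqrt_nonneg X

lemma psdSqrt_mul_psdSqrt (hX : 0 ≤ X) : psdSqrt X * psdSqrt X = X :=
  CFC.sqrt_mul_sqrt_self X hX

lemma psdSqrt_transpose (X : Matrix (Fin n) (Fin n) ℝ) : (psdSqrt X)ᵀ = psdSqrt X :=
  transpose_eq_of_nonneg (psdSqrt_nonneg X)

lemma inv_psdSqrt_transpose (X : Matrix (Fin n) (Fin n) ℝ) :
    (psdSqrt X)⁻¹ᵀ = (psdSqrt X)⁻¹ := by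
  rw [Matrix.transpose_nonsing_inv, psdSqrt_transpose]

lemma isUnit_det_psdSqrt (hX : 1 ≤ X) : IsUnit (psdSqrt X).det := by
  have h := isUnit_det_of_one_le hX
  rw [← psdSqrt_mul_psdSqrt (zero_le_one.trans hX), Matrix.det_mul] at h
  exact isUnit_of_mul_isUnit_left h

lemma norm_psdSqrt (hX : 0 ≤ X) : ‖psdSqrt X‖ = √‖X‖ := by
  rw [eq_comm, Real.sqrt_eq_iff_eq_sq (norm_nonneg _) (norm_nonneg _), ← norm_transpose_mul_self,
    psdSqrt_transpose, psdSqrt_mul_psdSqrt hX]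

lemma psdSqrt_mul_transpose_mul_psdSqrt_mul (hX : 0 ≤ X) (Y : Matrix (Fin n) (Fin l) ℝ) :
    (psdSqrt X * Y)ᵀ * (psdSqrt X * Y) = Yᵀ * X * Y := by
  conv_rhs => rw [← psdSqrt_mul_psdSqrt hX]
  simp only [Matrix.transpose_mul, psdSqrt_transpose, Matrix.mul_assoc]

lemma inv_psdSqrt_mul_mul_inv_psdSqrt (hX : 1 ≤ X) :
    (psdSqrt X)⁻¹ * X * (psdSqrt X)⁻¹ = 1 := by
  have hu := isUnit_det_psdSqrt hX
  have hsq := psdSqrt_mul_psdSqrt (zero_le_one.trans hX)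
  generalize psdSqrt X = L at hu hsq
  rw [← hsq, Matrix.nonsing_inv_mul_cancel_left _ _ hu, Matrix.mul_nonsing_inv _ hu]

lemma norm_mul_inv_psdSqrt_le (hX : 1 ≤ X) {V : Matrix (Fin l) (Fin n) ℝ} {c : ℝ} (hc : 0 ≤ c)
    (h : Vᵀ * V ≤ c ^ 2 • X) : ‖V * (psdSqrt X)⁻¹‖ ≤ c := by
  refine norm_le_of_transpose_mul_self_le hc ?_
  calc (V * (psdSqrt X)⁻¹)ᵀ * (V * (psdSqrt X)⁻¹)
      = (psdSqrt X)⁻¹ᵀ * (Vᵀ * V) * (psdSqrt X)⁻¹ := by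
        simp only [Matrix.transpose_mul, Matrix.mul_assoc]
    _ ≤ (psdSqrt X)⁻¹ᵀ * (c ^ 2 • X) * (psdSqrt X)⁻¹ := transpose_mul_mul_mono h _
    _ = c ^ 2 • 1 := by
        rw [inv_psdSqrt_transpose, Matrix.mul_smul, Matrix.smul_mul,
          inv_psdSqrt_mul_mul_inv_psdSqrt hX]

lemma norm_mul_inv_psdSqrt_le_one (hX : 1 ≤ X) {V : Matrix (Fin l) (Fin n) ℝ}
    (h : Vᵀ * V ≤ X) : ‖V * (psdSqrt X)⁻¹‖ ≤ 1 :=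
  norm_mul_inv_psdSqrt_le hX zero_le_one (by rwa [one_pow, one_smul])

lemma norm_inv_psdSqrt_le_one (hX : 1 ≤ X) : ‖(psdSqrt X)⁻¹‖ ≤ 1 := by
  rw [← Matrix.one_mul (psdSqrt X)⁻¹]
  exact norm_mul_inv_psdSqrt_le_one hX (by rwa [Matrix.transpose_one, Matrix.one_mul])

lemma matNorm_mul_le_matNorm_psdSqrt_mul (c : NormKind) (hX : 1 ≤ X)
    {V : Matrix (Fin l) (Fin n) ℝ} (h : Vᵀ * V ≤ X) (Y : Matrix (Fin n) (Fin k) ℝ) :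
    matNorm c (V * Y) ≤ matNorm c (psdSqrt X * Y) := by
  rw [← Matrix.nonsing_inv_mul_cancel_left _ Y (isUnit_det_psdSqrt hX), ← Matrix.mul_assoc,
    Matrix.mul_nonsing_inv_cancel_left _ _ (isUnit_det_psdSqrt hX)]
  exact (matNorm_mul_le_of_le_left (norm_mul_inv_psdSqrt_le_one hX h) le_rfl).trans_eq (one_mul _)

lemma matNorm_le_matNorm_psdSqrt_mul (c : NormKind) (hX : 1 ≤ X) (Y : Matrix (Fin n) (Fin k) ℝ) :
    matNorm c Y ≤ matNorm c (psdSqrt X * Y) := by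
  calc matNorm c Y = matNorm c (1 * Y) := by rw [Matrix.one_mul]
    _ ≤ matNorm c (psdSqrt X * Y) := matNorm_mul_le_matNorm_psdSqrt_mul c hX
        (by rwa [Matrix.transpose_one, Matrix.one_mul]) Y

lemma matNorm_inv_psdSqrt_mul_transpose_mul_le (c : NormKind) (hX : 1 ≤ X)
    {V : Matrix (Fin l) (Fin n) ℝ} (h : Vᵀ * V ≤ X) (Y : Matrix (Fin l) (Fin k) ℝ) :
    matNorm c ((psdSqrt X)⁻¹ * (Vᵀ * Y)) ≤ matNorm c Y := by
  rw [← Matrix.mul_assoc, ← inv_psdSqrt_transpose, ← Matrix.transpose_mul]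
  exact (matNorm_mul_le_of_le_left ((norm_transpose _).trans_le
    (norm_mul_inv_psdSqrt_le_one hX h)) le_rfl).trans_eq (one_mul _)

/-- The matrix of `M` in the coordinates `P^{1/2} x`, in which the quadratic form `P` is the
Euclidean one; meaningful for invertible `P`. -/
noncomputable def whitenMap (P M : Matrix (Fin n) (Fin n) ℝ) : Matrix (Fin n) (Fin n) ℝ :=
  psdSqrt P * M * (psdSqrt P)⁻¹

/-- The bilinear form `Δ` in the coordinates `Q^{1/2} x` and `P^{1/2} y`; meaningful for
invertible `P` and `Q`. -/
noncomputable def whitenForm (Q P Δ : Matrix (Fin n) (Fin n) ℝ) : Matrix (Fin n) (Fin n) ℝ :=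
  (psdSqrt Q)⁻¹ * Δ * (psdSqrt P)⁻¹

variable {P Q M N D E Δ W : Matrix (Fin n) (Fin n) ℝ}

lemma psdSqrt_mul_whitenForm_mul_psdSqrt (hQ : 1 ≤ Q) (hP : 1 ≤ P)
    (Δ : Matrix (Fin n) (Fin n) ℝ) : psdSqrt Q * whitenForm Q P Δ * psdSqrt P = Δ := by
  rw [whitenForm, Matrix.mul_assoc _⁻¹, Matrix.mul_nonsing_inv_cancel_left _ _
    (isUnit_det_psdSqrt hQ), Matrix.nonsing_inv_mul_cancel_right _ _ (isUnit_det_psdSqrt hP)]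

lemma whitenMap_transpose (P M : Matrix (Fin n) (Fin n) ℝ) :
    (whitenMap P M)ᵀ = (psdSqrt P)⁻¹ * Mᵀ * psdSqrt P := by
  rw [whitenMap, Matrix.transpose_mul, Matrix.transpose_mul, psdSqrt_transpose,
    inv_psdSqrt_transpose, Matrix.mul_assoc]

lemma matNorm_whitenForm_le_of_eq_add (c : NormKind) (hQ : 1 ≤ Q) (hP : 1 ≤ P)
    (h : Δ = Nᵀ * Δ * M + W) :
    (1 - ‖whitenMap Q N‖ * ‖whitenMap P M‖) * matNorm c (whitenForm Q P Δ) ≤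
      matNorm c (whitenForm Q P W) := by
  rw [← norm_transpose]
  refine matNorm_le_of_eq_mul_mul_add ?_
  have hΔ := psdSqrt_mul_whitenForm_mul_psdSqrt hQ hP Δ
  calc whitenForm Q P Δ
      = whitenForm Q P (Nᵀ * (psdSqrt Q * whitenForm Q P Δ * psdSqrt P) * M + W) := by
        rw [hΔ, ← h]
    _ = (whitenMap Q N)ᵀ * whitenForm Q P Δ * whitenMap P M + whitenForm Q P W := by
        rw [whitenMap_transpose, whitenMap]
        simp only [whitenForm, Matrix.mul_add, Matrix.add_mul, Matrix.mul_assoc]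

lemma matNorm_whitenForm_mul_add_mul_le (c : NormKind) (hQ : 1 ≤ Q) (hP : 1 ≤ P)
    (hN : ‖whitenMap Q N‖ ≤ 1) (hM : ‖whitenMap P M‖ ≤ 1) :
    matNorm c (whitenForm Q P (Nᵀ * Q * D + Eᵀ * P * M)) ≤
      √‖Q‖ * matNorm c D + √‖P‖ * matNorm c E := by
  have hsplit : whitenForm Q P (Nᵀ * Q * D + Eᵀ * P * M) =
      (whitenMap Q N)ᵀ * (psdSqrt Q * D * (psdSqrt P)⁻¹) +
        (psdSqrt Q)⁻¹ * Eᵀ * psdSqrt P * whitenMap P M := by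
    have hQsq (Y : Matrix (Fin n) (Fin n) ℝ) : Q * Y = psdSqrt Q * (psdSqrt Q * Y) := by
      rw [← Matrix.mul_assoc, psdSqrt_mul_psdSqrt (zero_le_one.trans hQ)]
    have hPsq (Y : Matrix (Fin n) (Fin n) ℝ) : P * Y = psdSqrt P * (psdSqrt P * Y) := by
      rw [← Matrix.mul_assoc, psdSqrt_mul_psdSqrt (zero_le_one.trans hP)]
    rw [whitenMap_transpose]
    simp only [whitenForm, whitenMap, Matrix.mul_add, Matrix.add_mul, Matrix.mul_assoc, hQsq, hPsq]
  have hD : matNorm c ((whitenMap Q N)ᵀ * (psdSqrt Q * D * (psdSqrt P)⁻¹)) ≤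
      1 * (√‖Q‖ * matNorm c D * 1) :=
    matNorm_mul_le_of_le_left ((norm_transpose _).trans_le hN)
      (matNorm_mul_le_of_le_right
        (matNorm_mul_le_of_le_left (norm_psdSqrt (zero_le_one.trans hQ)).le le_rfl)
        (norm_inv_psdSqrt_le_one hP))
  have hE : matNorm c ((psdSqrt Q)⁻¹ * Eᵀ * psdSqrt P * whitenMap P M) ≤
      1 * matNorm c E * √‖P‖ * 1 :=
    matNorm_mul_le_of_le_right
      (matNorm_mul_le_of_le_right
        (matNorm_mul_le_of_le_left (norm_inv_psdSqrt_le_one hQ) (matNorm_transpose c E).le)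
        (norm_psdSqrt (zero_le_one.trans hP)).le) hM
  rw [hsplit]
  linarith [matNorm_add_le c ((whitenMap Q N)ᵀ * (psdSqrt Q * D * (psdSqrt P)⁻¹))
    ((psdSqrt Q)⁻¹ * Eᵀ * psdSqrt P * whitenMap P M)]

end SquareRoot

section Perturbation

variable {m n : ℕ} {Rx : Matrix (Fin n) (Fin n) ℝ} {Ru : Matrix (Fin m) (Fin m) ℝ}
  {A A' : Matrix (Fin n) (Fin n) ℝ} {B B' : Matrix (Fin n) (Fin m) ℝ}
  {P P' : Matrix (Fin n) (Fin n) ℝ}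

lemma sysDist_nonneg (c : NormKind) (A A' : Matrix (Fin n) (Fin n) ℝ)
    (B B' : Matrix (Fin n) (Fin m) ℝ) : 0 ≤ sysDist c A B A' B' :=
  (matNorm_nonneg c _).trans (le_max_left _ _)

lemma matNorm_input_sub_le_sysDist (c : NormKind) (A A' : Matrix (Fin n) (Fin n) ℝ)
    (B B' : Matrix (Fin n) (Fin m) ℝ) : matNorm c (B' - B) ≤ sysDist c A B A' B' := by
  rw [← neg_sub, matNorm_neg]
  exact le_max_right _ _

lemma matNorm_state_sub_le_sysDist (c : NormKind) (A A' : Matrix (Fin n) (Fin n) ℝ)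
    (B B' : Matrix (Fin n) (Fin m) ℝ) : matNorm c (A' - A) ≤ sysDist c A B A' B' := by
  rw [← neg_sub, matNorm_neg]
  exact le_max_left _ _

/-- The difference between the closed loops of `(A', B')` and `(A, B)` under the same feedback
`u = K x`. -/
def closedLoopError (A : Matrix (Fin n) (Fin n) ℝ) (B : Matrix (Fin n) (Fin m) ℝ)
    (A' : Matrix (Fin n) (Fin n) ℝ) (B' : Matrix (Fin n) (Fin m) ℝ)
    (K : Matrix (Fin m) (Fin n) ℝ) : Matrix (Fin n) (Fin n) ℝ :=
  (A' - A) + (B' - B) * K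

lemma closedLoop_add_closedLoopError (A A' : Matrix (Fin n) (Fin n) ℝ)
    (B B' : Matrix (Fin n) (Fin m) ℝ) (K : Matrix (Fin m) (Fin n) ℝ) :
    (A + B * K) + closedLoopError A B A' B' K = A' + B' * K := by
  rw [closedLoopError, Matrix.sub_mul]
  abel

lemma matNorm_closedLoopError_le (c : NormKind) {K : Matrix (Fin m) (Fin n) ℝ} {a : ℝ}
    (hK : 1 + ‖K‖ ≤ a) :
    matNorm c (closedLoopError A B A' B' K) ≤ a * sysDist c A B A' B' := by
  calc matNorm c (closedLoopError A B A' B' K)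
      ≤ matNorm c (A' - A) + matNorm c ((B' - B) * K) := matNorm_add_le c _ _
    _ ≤ sysDist c A B A' B' + sysDist c A B A' B' * ‖K‖ :=
        add_le_add (matNorm_state_sub_le_sysDist c A A' B B')
          (matNorm_mul_le_of_le_right (matNorm_input_sub_le_sysDist c A A' B B') le_rfl)
    _ = (1 + ‖K‖) * sysDist c A B A' B' := by ring
    _ ≤ a * sysDist c A B A' B' :=
        mul_le_mul_of_nonneg_right hK (sysDist_nonneg c A A' B B')

lemma inv_one_sub_half_le_rpow {α : ℝ} (hα1 : α < 1) :
    (1 - α / 2)⁻¹ ≤ (1 - α) ^ (-(1 / 2) : ℝ) := by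
  have hpos : 0 < 1 - α := sub_pos.mpr hα1
  rw [Real.rpow_neg hpos.le, ← Real.sqrt_eq_rpow]
  refine inv_anti₀ (Real.sqrt_pos.mpr hpos) (Real.sqrt_le_iff.mpr ⟨by linarith, ?_⟩)
  linarith [sq_nonneg (α / 2)]

lemma sqrt_one_sub_inv_mul_sqrt_one_sub_inv_le {p q : ℝ} (hp : 1 ≤ p) (hq : 1 ≤ q) :
    √(1 - p⁻¹) * √(1 - q⁻¹) ≤ 1 - (√p * √q)⁻¹ := by
  have hp' := inv_le_one_of_one_le₀ hp
  have hpq : (√p * √q)⁻¹ ≤ 1 := by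
    rw [← Real.sqrt_mul (by linarith)]
    exact inv_le_one_of_one_le₀ (Real.one_le_sqrt.mpr (one_le_mul_of_one_le_of_one_le hp hq))
  have hx : (√p)⁻¹ ^ 2 = p⁻¹ := by rw [inv_pow, Real.sq_sqrt (by linarith)]
  have hy : (√q)⁻¹ ^ 2 = q⁻¹ := by rw [inv_pow, Real.sq_sqrt (by linarith)]
  rw [← Real.sqrt_mul (by linarith)]
  refine Real.sqrt_le_iff.mpr ⟨by linarith, ?_⟩
  rw [← hx, ← hy, mul_inv]
  linarith [sq_nonneg ((√p)⁻¹ - (√q)⁻¹)]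

namespace IsDARESolution

section ClosedLoopBounds

lemma norm_psdSqrt_mul_closedLoop_le (h : IsDARESolution Rx Ru A B P) (hRx : 0 ≤ Rx)
    (hRu : 1 ≤ Ru) : ‖psdSqrt P * (A + B * gain Ru A B P)‖ ≤ √‖P‖ := by
  refine norm_le_of_transpose_mul_self_le (Real.sqrt_nonneg _) ?_
  rw [psdSqrt_mul_transpose_mul_psdSqrt_mul h.nonneg, Real.sq_sqrt (norm_nonneg P)]
  have hcost : 0 ≤ stageCost Rx Ru (gain Ru A B P) :=
    add_nonneg hRx (transpose_mul_mul_nonneg (zero_le_one.trans hRu) _)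
  exact (le_add_of_nonneg_right hcost).trans
    ((h.policyOp_gain_eq hRu).trans_le (le_norm_smul_one (.of_nonneg h.nonneg)))

variable [Nonempty (Fin n)]

lemma one_le_norm (h : IsDARESolution Rx Ru A B P) (hRx : 1 ≤ Rx) (hRu : 1 ≤ Ru) : 1 ≤ ‖P‖ :=
  LQR.one_le_norm (h.one_le hRx hRu)

lemma one_add_norm_gain_sq_le (h : IsDARESolution Rx Ru A B P) (hRx : 1 ≤ Rx) (hRu : 1 ≤ Ru) :
    1 + ‖gain Ru A B P‖ ^ 2 ≤ ‖P‖ := by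
  set G := gain Ru A B P
  have hG : Gᵀ * G ≤ Gᵀ * Ru * G := by simpa using transpose_mul_mul_mono hRu G
  have hle : Gᵀ * G ≤ (‖P‖ - 1) • 1 := by
    rw [sub_smul, one_smul, le_sub_iff_add_le, add_comm]
    exact (add_le_add hRx hG).trans
      ((h.stageCost_le hRu).trans (le_norm_smul_one (.of_nonneg h.nonneg)))
  rw [← norm_transpose_mul_self, ← le_sub_iff_add_le']
  exact norm_le_of_nonneg_of_le_smul_one (transpose_mul_self_nonneg G)
    (sub_nonneg.mpr (h.one_le_norm hRx hRu)) hle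

lemma one_add_norm_gain_le (h : IsDARESolution Rx Ru A B P) (hRx : 1 ≤ Rx) (hRu : 1 ≤ Ru) :
    1 + ‖gain Ru A B P‖ ≤ 3 / 2 * √‖P‖ := by
  refine le_of_sq_le_sq ?_ (by positivity)
  rw [mul_pow, Real.sq_sqrt (norm_nonneg P)]
  linarith [h.one_add_norm_gain_sq_le hRx hRu, sq_nonneg (‖gain Ru A B P‖ - 1), norm_nonneg P]

lemma norm_whitenMap_closedLoop_le (h : IsDARESolution Rx Ru A B P) (hRx : 1 ≤ Rx)
    (hRu : 1 ≤ Ru) : ‖whitenMap P (A + B * gain Ru A B P)‖ ≤ √(1 - ‖P‖⁻¹) := by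
  have hp := h.one_le_norm hRx hRu
  refine norm_mul_inv_psdSqrt_le (h.one_le hRx hRu) (Real.sqrt_nonneg _) ?_
  rw [Real.sq_sqrt (sub_nonneg.mpr (inv_le_one_of_one_le₀ hp)),
    psdSqrt_mul_transpose_mul_psdSqrt_mul h.nonneg, sub_smul, one_smul, le_sub_iff_add_le]
  have hcost : ‖P‖⁻¹ • P ≤ stageCost Rx Ru (gain Ru A B P) := by
    refine le_trans ?_ (one_le_stageCost hRx (zero_le_one.trans hRu) _)
    rw [inv_smul_le_iff_of_pos (by linarith)]
    exact le_norm_smul_one (.of_nonneg h.nonneg)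
  exact (add_le_add_right hcost _).trans (h.policyOp_gain_eq hRu).le

lemma norm_whitenMap_closedLoop_le_one (h : IsDARESolution Rx Ru A B P) (hRx : 1 ≤ Rx)
    (hRu : 1 ≤ Ru) : ‖whitenMap P (A + B * gain Ru A B P)‖ ≤ 1 :=
  (h.norm_whitenMap_closedLoop_le hRx hRu).trans
    (Real.sqrt_le_one.mpr (sub_le_self _ (inv_nonneg.mpr (norm_nonneg P))))

end ClosedLoopBounds

section PerturbedCertificate

variable {α : ℝ}

lemma closedLoopError_quadratic_le [Nonempty (Fin n)] (h : IsDARESolution Rx Ru A B P)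
    (hRx : 1 ≤ Rx) (hRu : 1 ≤ Ru) (hα : 8 * ‖P‖ ^ 2 * sysDist .op A B A' B' ≤ α) (hα1 : α < 1) :
    2 * ‖psdSqrt P * (A + B * gain Ru A B P)‖ *
        ‖psdSqrt P * closedLoopError A B A' B' (gain Ru A B P)‖ +
      ‖psdSqrt P * closedLoopError A B A' B' (gain Ru A B P)‖ ^ 2 ≤ α / 2 := by
  have hp := h.one_le_norm hRx hRu
  have hM := h.norm_psdSqrt_mul_closedLoop_le (zero_le_one.trans hRx) hRu
  have hD : ‖psdSqrt P * closedLoopError A B A' B' (gain Ru A B P)‖ ≤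
      √‖P‖ * (3 / 2 * √‖P‖ * sysDist .op A B A' B') :=
    matNorm_mul_le_of_le_left (c := .op) (norm_psdSqrt h.nonneg).le
      (matNorm_closedLoopError_le .op (h.one_add_norm_gain_le hRx hRu))
  have he := sysDist_nonneg .op A A' B B'
  generalize sysDist .op A B A' B' = e at *
  have hs : √‖P‖ * √‖P‖ = ‖P‖ := Real.mul_self_sqrt (norm_nonneg P)
  have hsp : √‖P‖ ≤ ‖P‖ := Real.sqrt_le_self_iff.mpr (.inr hp)
  have hpe : ‖P‖ * e ≤ ‖P‖ ^ 2 * e := by gcongr; exact le_self_pow₀ hp two_ne_zero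
  calc _ ≤ 2 * √‖P‖ * (√‖P‖ * (3 / 2 * √‖P‖ * e)) + (√‖P‖ * (3 / 2 * √‖P‖ * e)) ^ 2 := by gcongr
    _ = 3 * (√‖P‖ * (‖P‖ * e)) + 9 / 4 * (‖P‖ * e * (‖P‖ * e)) := by
      linear_combination (3 * √‖P‖ * e + 9 / 4 * e ^ 2 * (√‖P‖ * √‖P‖ + ‖P‖)) * hs
    _ ≤ 3 * (‖P‖ * (‖P‖ * e)) + 9 / 4 * (1 / 8 * (‖P‖ ^ 2 * e)) := by gcongr; linarith
    _ ≤ α / 2 := by nlinarith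

theorem isLyapunovCertificate_perturbed (h : IsDARESolution Rx Ru A B P) (hRx : 1 ≤ Rx)
    (hRu : 1 ≤ Ru) (hα : 8 * ‖P‖ ^ 2 * sysDist .op A B A' B' ≤ α) (hα1 : α < 1) :
    IsLyapunovCertificate (A' + B' * gain Ru A B P) (stageCost Rx Ru (gain Ru A B P))
      ((1 - α / 2)⁻¹ • P) := by
  have hα0 : 0 ≤ α := le_trans (by have := sysDist_nonneg .op A A' B B'; positivity) hα
  refine (h.isLyapunovCertificate hRu).inv_smul_of_perturbed
    (one_le_stageCost hRx (zero_le_one.trans hRu) _) (by linarith) (by linarith) ?_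
  rcases isEmpty_or_nonempty (Fin n)
  · exact (Subsingleton.elim _ _).le
  rw [← closedLoop_add_closedLoopError A A', ← psdSqrt_mul_transpose_mul_psdSqrt_mul h.nonneg,
    ← psdSqrt_mul_transpose_mul_psdSqrt_mul h.nonneg, Matrix.mul_add]
  refine (add_transpose_mul_add_le _ _).trans (add_le_add_right ?_ _)
  refine smul_le_smul_of_nonneg_right ?_ zero_le_one
  exact h.closedLoopError_quadratic_le hRx hRu hα hα1

theorem norm_le_rpow_mul_norm (h : IsDARESolution Rx Ru A B P)
    (h' : IsDARESolution Rx Ru A' B' P') (hRx : 1 ≤ Rx) (hRu : 1 ≤ Ru)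
    (hα : 8 * ‖P‖ ^ 2 * sysDist .op A B A' B' ≤ α) (hα1 : α < 1) :
    ‖P'‖ ≤ (1 - α) ^ (-(1 / 2) : ℝ) * ‖P‖ := by
  have hpos : 0 ≤ (1 - α / 2)⁻¹ := inv_nonneg.mpr (by linarith)
  calc ‖P'‖ ≤ ‖(1 - α / 2)⁻¹ • P‖ := norm_le_norm_of_nonneg_of_le h'.nonneg
        (h'.le_of_isLyapunovCertificate hRx hRu
          (h.isLyapunovCertificate_perturbed hRx hRu hα hα1))
    _ = (1 - α / 2)⁻¹ * ‖P‖ := by rw [norm_smul, Real.norm_of_nonneg hpos]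
    _ ≤ (1 - α) ^ (-(1 / 2) : ℝ) * ‖P‖ :=
        mul_le_mul_of_nonneg_right (inv_one_sub_half_le_rpow hα1) (norm_nonneg P)

end PerturbedCertificate

section Difference

lemma mixed_policyOp_eq_self (h : IsDARESolution Rx Ru A B P) (hRu : 1 ≤ Ru)
    (K : Matrix (Fin m) (Fin n) ℝ) :
    (A + B * K)ᵀ * P * (A + B * gain Ru A B P) + (Rx + Kᵀ * Ru * gain Ru A B P) = P := by
  rw [mixed_policyOp_eq hRu h.nonneg, ← mixed_policyOp_eq hRu h.nonneg (gain Ru A B P)]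
  exact h.policyOp_gain_eq hRu

/-- Each Riccati equation is tested against the optimal feedback of the other system, which
cancels the cost terms. -/
theorem sub_eq (h : IsDARESolution Rx Ru A B P) (h' : IsDARESolution Rx Ru A' B' P')
    (hRx : 0 ≤ Rx) (hRu : 1 ≤ Ru) :
    P' - P = (A' + B' * gain Ru A' B' P')ᵀ * (P' - P) * (A + B * gain Ru A B P) +
      ((A' + B' * gain Ru A' B' P')ᵀ * P' * closedLoopError A B A' B' (gain Ru A B P) +
        (closedLoopError A B A' B' (gain Ru A' B' P'))ᵀ * P * (A + B * gain Ru A B P)) := by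
  have hmix := h.mixed_policyOp_eq_self hRu (gain Ru A' B' P')
  have hmix' : (A' + B' * gain Ru A' B' P')ᵀ * P' * (A' + B' * gain Ru A B P) +
      (Rx + (gain Ru A' B' P')ᵀ * Ru * gain Ru A B P) = P' := by
    refine Matrix.transpose_injective (Eq.trans ?_ ((h'.mixed_policyOp_eq_self hRu
      (gain Ru A B P)).trans (transpose_eq_of_nonneg h'.nonneg).symm))
    simp only [Matrix.transpose_add, Matrix.transpose_mul, Matrix.transpose_transpose,
      transpose_eq_of_nonneg h'.nonneg, transpose_eq_of_nonneg hRx,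
      transpose_eq_of_nonneg (zero_le_one.trans hRu), Matrix.mul_assoc]
  have hD := closedLoop_add_closedLoopError A A' B B' (gain Ru A B P)
  have hD' := closedLoop_add_closedLoopError A A' B B' (gain Ru A' B' P')
  calc P' - P = (A' + B' * gain Ru A' B' P')ᵀ * P' * (A' + B' * gain Ru A B P) -
        (A + B * gain Ru A' B' P')ᵀ * P * (A + B * gain Ru A B P) :=
        (congrArg₂ (· - ·) hmix' hmix).symm.trans (add_sub_add_right_eq_sub _ _ _)
    _ = _ := by
        rw [← hD, ← hD', Matrix.transpose_add]
        simp only [Matrix.mul_add, Matrix.add_mul, Matrix.mul_sub, Matrix.sub_mul]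
        abel

theorem matNorm_whitenForm_sub_le [Nonempty (Fin n)] (c : NormKind)
    (h : IsDARESolution Rx Ru A B P) (h' : IsDARESolution Rx Ru A' B' P') (hRx : 1 ≤ Rx)
    (hRu : 1 ≤ Ru) :
    matNorm c (whitenForm P' P (P' - P)) ≤ 3 * (‖P‖ * ‖P'‖) * sysDist c A B A' B' := by
  have hp := h.one_le_norm hRx hRu
  have hq := h'.one_le_norm hRx hRu
  have hgap : (√‖P'‖ * √‖P‖)⁻¹ ≤ 1 - ‖whitenMap P' (A' + B' * gain Ru A' B' P')‖ *
      ‖whitenMap P (A + B * gain Ru A B P)‖ := by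
    refine le_sub_comm.mp (le_trans ?_ (sqrt_one_sub_inv_mul_sqrt_one_sub_inv_le hq hp))
    exact mul_le_mul (h'.norm_whitenMap_closedLoop_le hRx hRu)
      (h.norm_whitenMap_closedLoop_le hRx hRu) (norm_nonneg _) (Real.sqrt_nonneg _)
  have hD := matNorm_closedLoopError_le c (A := A) (A' := A') (B := B) (B' := B')
    (h.one_add_norm_gain_le hRx hRu)
  have hD' := matNorm_closedLoopError_le c (A := A) (A' := A') (B := B) (B' := B')
    (h'.one_add_norm_gain_le hRx hRu)
  have hstein := (matNorm_whitenForm_le_of_eq_add c (h'.one_le hRx hRu) (h.one_le hRx hRu)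
    (h.sub_eq h' (zero_le_one.trans hRx) hRu)).trans
      (matNorm_whitenForm_mul_add_mul_le c (h'.one_le hRx hRu) (h.one_le hRx hRu)
        (h'.norm_whitenMap_closedLoop_le_one hRx hRu) (h.norm_whitenMap_closedLoop_le_one hRx hRu))
  have hscaled : (√‖P'‖ * √‖P‖)⁻¹ * matNorm c (whitenForm P' P (P' - P)) ≤
      3 * (√‖P‖ * √‖P'‖) * sysDist c A B A' B' :=
    calc _ ≤ √‖P'‖ * matNorm c (closedLoopError A B A' B' (gain Ru A B P)) +
          √‖P‖ * matNorm c (closedLoopError A B A' B' (gain Ru A' B' P')) :=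
          (mul_le_mul_of_nonneg_right hgap (matNorm_nonneg c _)).trans hstein
      _ ≤ √‖P'‖ * (3 / 2 * √‖P‖ * sysDist c A B A' B') +
          √‖P‖ * (3 / 2 * √‖P'‖ * sysDist c A B A' B') := by gcongr
      _ = 3 * (√‖P‖ * √‖P'‖) * sysDist c A B A' B' := by ring
  rw [inv_mul_le_iff₀ (by positivity)] at hscaled
  refine hscaled.trans_eq ?_
  linear_combination 3 * sysDist c A B A' B' * (√‖P'‖ ^ 2 * Real.sq_sqrt (norm_nonneg P) +
    ‖P‖ * Real.sq_sqrt (norm_nonneg P'))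

end Difference

end IsDARESolution

section InputWeight

variable {l : ℕ}

lemma one_le_inputWeight (hRu : 1 ≤ Ru) (hP : 0 ≤ P) (B : Matrix (Fin n) (Fin m) ℝ) :
    1 ≤ inputWeight Ru B P :=
  hRu.trans (le_inputWeight hP B)

lemma psdSqrt_mul_input_transpose_mul_self_le (hRu : 0 ≤ Ru) (hP : 0 ≤ P)
    (B : Matrix (Fin n) (Fin m) ℝ) :
    (psdSqrt P * B)ᵀ * (psdSqrt P * B) ≤ inputWeight Ru B P := by
  rw [psdSqrt_mul_transpose_mul_psdSqrt_mul hP]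
  exact le_add_of_nonneg_left hRu

lemma matNorm_psdSqrt_mul_le_matNorm_psdSqrt_inputWeight_mul (c : NormKind) (hRu : 1 ≤ Ru)
    (hP : 0 ≤ P) (B : Matrix (Fin n) (Fin m) ℝ) (E : Matrix (Fin m) (Fin l) ℝ) :
    matNorm c (psdSqrt Ru * E) ≤ matNorm c (psdSqrt (inputWeight Ru B P) * E) := by
  refine matNorm_mul_le_matNorm_psdSqrt_mul c (one_le_inputWeight hRu hP B) ?_ E
  rw [psdSqrt_transpose, psdSqrt_mul_psdSqrt (zero_le_one.trans hRu)]
  exact le_inputWeight hP B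

lemma matNorm_input_mul_le_matNorm_psdSqrt_inputWeight_mul (c : NormKind) (hRu : 1 ≤ Ru)
    (hP : 1 ≤ P) (B : Matrix (Fin n) (Fin m) ℝ) (E : Matrix (Fin m) (Fin l) ℝ) :
    matNorm c (B * E) ≤ matNorm c (psdSqrt (inputWeight Ru B P) * E) := by
  have hP0 := zero_le_one.trans hP
  refine matNorm_mul_le_matNorm_psdSqrt_mul c (one_le_inputWeight hRu hP0 B) ?_ E
  calc Bᵀ * B = Bᵀ * 1 * B := by rw [Matrix.mul_one]
    _ ≤ Bᵀ * P * B := transpose_mul_mul_mono hP B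
    _ ≤ inputWeight Ru B P := le_add_of_nonneg_left (zero_le_one.trans hRu)

lemma matNorm_input_mul_le_of_norm_input_sub_le (c : NormKind) (hRu : 1 ≤ Ru) (hP : 1 ≤ P)
    {δ : ℝ} (hB : ‖B' - B‖ ≤ δ) (E : Matrix (Fin m) (Fin l) ℝ) :
    matNorm c (B * E) ≤ (1 + δ) * matNorm c (psdSqrt (inputWeight Ru B' P) * E) := by
  have hsub : matNorm c ((B' - B) * E) ≤ δ * matNorm c (psdSqrt (inputWeight Ru B' P) * E) :=
    matNorm_mul_le_of_le_left hB
      (matNorm_le_matNorm_psdSqrt_mul c (one_le_inputWeight hRu (zero_le_one.trans hP) B') E)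
  calc matNorm c (B * E) = matNorm c (B' * E + -((B' - B) * E)) := by
        rw [Matrix.sub_mul, neg_sub, add_sub_cancel]
    _ ≤ matNorm c (B' * E) + matNorm c ((B' - B) * E) :=
        (matNorm_add_le c _ _).trans_eq (by rw [matNorm_neg])
    _ ≤ (1 + δ) * matNorm c (psdSqrt (inputWeight Ru B' P) * E) := by
        linarith [matNorm_input_mul_le_matNorm_psdSqrt_inputWeight_mul c hRu hP B' E]

lemma inputWeight_mul_gain_sub (hRu : 1 ≤ Ru) (hP : 0 ≤ P) (hP' : 0 ≤ P') :
    inputWeight Ru B' P' * (gain Ru A' B' P' - gain Ru A B P) =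
      -(B'ᵀ * P' * closedLoopError A B A' B' (gain Ru A B P) +
        B'ᵀ * (P' - P) * (A + B * gain Ru A B P) +
        (B' - B)ᵀ * P * (A + B * gain Ru A B P)) := by
  rw [Matrix.mul_sub, inputWeight_mul_gain hRu hP', inputWeight, Matrix.add_mul,
    eq_neg_of_add_eq_zero_right (gain_stationary hRu hP)]
  simp only [closedLoopError, Matrix.transpose_sub, Matrix.mul_add, Matrix.mul_sub,
    Matrix.sub_mul, Matrix.mul_assoc]
  abel

end InputWeight

namespace IsDARESolution

section GainDifference

lemma psdSqrt_inputWeight_mul_gain_sub (h : IsDARESolution Rx Ru A B P)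
    (h' : IsDARESolution Rx Ru A' B' P') (hRx : 1 ≤ Rx) (hRu : 1 ≤ Ru) :
    psdSqrt (inputWeight Ru B' P') * (gain Ru A' B' P' - gain Ru A B P) =
      -((psdSqrt (inputWeight Ru B' P'))⁻¹ * ((psdSqrt P' * B')ᵀ *
          (psdSqrt P' * closedLoopError A B A' B' (gain Ru A B P) +
            whitenForm P' P (P' - P) * (psdSqrt P * (A + B * gain Ru A B P)))) +
        (psdSqrt (inputWeight Ru B' P'))⁻¹ *
          ((B' - B)ᵀ * psdSqrt P * (psdSqrt P * (A + B * gain Ru A B P)))) := by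
  have hW := one_le_inputWeight hRu h'.nonneg B'
  have hP' (Y : Matrix (Fin n) (Fin n) ℝ) : psdSqrt P' * (psdSqrt P' * Y) = P' * Y := by
    rw [← Matrix.mul_assoc, psdSqrt_mul_psdSqrt h'.nonneg]
  have hP (Y : Matrix (Fin n) (Fin n) ℝ) : psdSqrt P * (psdSqrt P * Y) = P * Y := by
    rw [← Matrix.mul_assoc, psdSqrt_mul_psdSqrt h.nonneg]
  have hΔ (Y : Matrix (Fin n) (Fin n) ℝ) :
      psdSqrt P' * (whitenForm P' P (P' - P) * (psdSqrt P * Y)) = (P' - P) * Y := by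
    rw [← Matrix.mul_assoc, ← Matrix.mul_assoc,
      psdSqrt_mul_whitenForm_mul_psdSqrt (h'.one_le hRx hRu) (h.one_le hRx hRu)]
  rw [← Matrix.nonsing_inv_mul_cancel_left _ (psdSqrt (inputWeight Ru B' P') * _)
      (isUnit_det_psdSqrt hW), ← Matrix.mul_assoc (psdSqrt _) (psdSqrt _),
    psdSqrt_mul_psdSqrt (zero_le_one.trans hW), inputWeight_mul_gain_sub hRu h.nonneg h'.nonneg,
    Matrix.mul_neg, ← Matrix.mul_add]
  simp only [Matrix.transpose_mul, psdSqrt_transpose, Matrix.mul_assoc, Matrix.mul_add, hP, hP',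
    hΔ]

variable [Nonempty (Fin n)]

theorem matNorm_psdSqrt_inputWeight_mul_gain_sub_le (c : NormKind)
    (h : IsDARESolution Rx Ru A B P) (h' : IsDARESolution Rx Ru A' B' P') (hRx : 1 ≤ Rx)
    (hRu : 1 ≤ Ru) :
    matNorm c (psdSqrt (inputWeight Ru B' P') * (gain Ru A' B' P' - gain Ru A B P)) ≤
      (3 / 2 * (√‖P‖ * √‖P'‖) + 3 * (‖P‖ * ‖P'‖) * √‖P‖ + ‖P‖) * sysDist c A B A' B' := by
  have hW := one_le_inputWeight hRu h'.nonneg B'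
  have hM := h.norm_psdSqrt_mul_closedLoop_le (zero_le_one.trans hRx) hRu
  have hD := matNorm_mul_le_of_le_left (norm_psdSqrt h'.nonneg).le
    (matNorm_closedLoopError_le c (A := A) (A' := A') (B := B) (B' := B')
      (h.one_add_norm_gain_le hRx hRu))
  have hΔ := matNorm_mul_le_of_le_right (h.matNorm_whitenForm_sub_le c h' hRx hRu) hM
  have hB : matNorm c (B' - B)ᵀ ≤ sysDist c A B A' B' :=
    (matNorm_transpose c _).trans_le (matNorm_input_sub_le_sysDist c A A' B B')
  have hBM := matNorm_mul_le_of_le_left (norm_inv_psdSqrt_le_one hW)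
    (matNorm_mul_le_of_le_right (matNorm_mul_le_of_le_right hB (norm_psdSqrt h.nonneg).le) hM)
  rw [h.psdSqrt_inputWeight_mul_gain_sub h' hRx hRu, matNorm_neg]
  refine (matNorm_add_le c _ _).trans ?_
  refine (add_le_add ((matNorm_inv_psdSqrt_mul_transpose_mul_le c hW
    (psdSqrt_mul_input_transpose_mul_self_le (zero_le_one.trans hRu) h'.nonneg B') _).trans
      ((matNorm_add_le c _ _).trans (add_le_add hD hΔ))) hBM).trans_eq ?_
  linear_combination sysDist c A B A' B' * Real.mul_self_sqrt (norm_nonneg P)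

lemma sqrt_norm_mul_matNorm_psdSqrt_inputWeight_mul_gain_sub_le (c : NormKind)
    (h : IsDARESolution Rx Ru A B P) (h' : IsDARESolution Rx Ru A' B' P') (hRx : 1 ≤ Rx)
    (hRu : 1 ≤ Ru) :
    √‖P‖ * matNorm c (psdSqrt (inputWeight Ru B' P') * (gain Ru A' B' P' - gain Ru A B P)) ≤
      11 / 2 * (‖P'‖ * ‖P‖ ^ 2 * sysDist c A B A' B') := by
  have hp := h.one_le_norm hRx hRu
  have hq := h'.one_le_norm hRx hRu
  have hs := Real.mul_self_sqrt (norm_nonneg P)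
  have hsp : √‖P‖ ≤ ‖P‖ := Real.sqrt_le_self_iff.mpr (.inr hp)
  have htq : √‖P'‖ ≤ ‖P'‖ := Real.sqrt_le_self_iff.mpr (.inr hq)
  have he := sysDist_nonneg c A A' B B'
  have hp2 : ‖P‖ ≤ ‖P‖ ^ 2 := le_self_pow₀ hp two_ne_zero
  have hlast : √‖P‖ * ‖P‖ ≤ ‖P‖ ^ 2 * ‖P'‖ :=
    calc √‖P‖ * ‖P‖ ≤ ‖P‖ ^ 2 := by rw [sq]; gcongr
      _ ≤ ‖P‖ ^ 2 * ‖P'‖ := le_mul_of_one_le_right (by positivity) hq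
  calc _ ≤ √‖P‖ * ((3 / 2 * (√‖P‖ * √‖P'‖) + 3 * (‖P‖ * ‖P'‖) * √‖P‖ + ‖P‖) *
        sysDist c A B A' B') :=
        mul_le_mul_of_nonneg_left (h.matNorm_psdSqrt_inputWeight_mul_gain_sub_le c h' hRx hRu)
          (Real.sqrt_nonneg _)
    _ = (3 / 2 * (‖P‖ * √‖P'‖) + 3 * (‖P‖ ^ 2 * ‖P'‖) + √‖P‖ * ‖P‖) * sysDist c A B A' B' := by
        linear_combination (3 / 2 * √‖P'‖ + 3 * (‖P‖ * ‖P'‖)) * sysDist c A B A' B' * hs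
    _ ≤ (3 / 2 * (‖P‖ ^ 2 * ‖P'‖) + 3 * (‖P‖ ^ 2 * ‖P'‖) + ‖P‖ ^ 2 * ‖P'‖) *
        sysDist c A B A' B' := by gcongr
    _ = 11 / 2 * (‖P'‖ * ‖P‖ ^ 2 * sysDist c A B A' B') := by ring

variable {α : ℝ}

lemma norm_mul_norm_sq_le (h : IsDARESolution Rx Ru A B P) (h' : IsDARESolution Rx Ru A' B' P')
    (hRx : 1 ≤ Rx) (hRu : 1 ≤ Ru) (hα : 8 * ‖P‖ ^ 2 * sysDist .op A B A' B' ≤ α) (hα1 : α < 1) :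
    ‖P'‖ * ‖P‖ ^ 2 ≤ (1 - α) ^ (-(7 / 4) : ℝ) * ‖P‖ ^ (7 / 2 : ℝ) := by
  have hp := h.one_le_norm hRx hRu
  have hα0 : 0 ≤ α := le_trans (by have := sysDist_nonneg .op A A' B B'; positivity) hα
  have hrate : (1 - α) ^ (-(1 / 2) : ℝ) ≤ (1 - α) ^ (-(7 / 4) : ℝ) :=
    Real.rpow_le_rpow_of_exponent_ge (by linarith) (by linarith) (by norm_num)
  have hpow : ‖P‖ ^ 3 ≤ ‖P‖ ^ (7 / 2 : ℝ) := by
    rw [← Real.rpow_natCast]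
    exact Real.rpow_le_rpow_of_exponent_le hp (by norm_num)
  calc ‖P'‖ * ‖P‖ ^ 2 ≤ (1 - α) ^ (-(1 / 2) : ℝ) * ‖P‖ * ‖P‖ ^ 2 := by
        gcongr
        exact h.norm_le_rpow_mul_norm h' hRx hRu hα hα1
    _ = (1 - α) ^ (-(1 / 2) : ℝ) * ‖P‖ ^ 3 := by ring
    _ ≤ (1 - α) ^ (-(7 / 4) : ℝ) * ‖P‖ ^ (7 / 2 : ℝ) :=
        mul_le_mul hrate hpow (by positivity) (Real.rpow_nonneg (by linarith) _)

lemma norm_input_sub_le (h : IsDARESolution Rx Ru A B P) (hRx : 1 ≤ Rx) (hRu : 1 ≤ Ru)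
    (hα : 8 * ‖P‖ ^ 2 * sysDist .op A B A' B' ≤ α) (hα1 : α < 1) : ‖B' - B‖ ≤ 1 / 8 := by
  have hp2 : 1 ≤ ‖P‖ ^ 2 := one_le_pow₀ (h.one_le_norm hRx hRu)
  have hB : ‖B' - B‖ ≤ sysDist .op A B A' B' := matNorm_input_sub_le_sysDist .op A A' B B'
  linarith [le_mul_of_one_le_left (sysDist_nonneg .op A A' B B') hp2]

end GainDifference

theorem matNorm_gain_sub_le {α : ℝ} (c : NormKind) (h : IsDARESolution Rx Ru A B P)
    (h' : IsDARESolution Rx Ru A' B' P') (hRx : 1 ≤ Rx) (hRu : 1 ≤ Ru)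
    (hα : 8 * ‖P‖ ^ 2 * sysDist .op A B A' B' ≤ α) (hα1 : α < 1) :
    matNorm c (gain Ru A' B' P' - gain Ru A B P) ≤
        7 * (1 - α) ^ (-(7 / 4) : ℝ) * ‖P‖ ^ (7 / 2 : ℝ) * sysDist c A B A' B' ∧
      matNorm c (psdSqrt Ru * (gain Ru A' B' P' - gain Ru A B P)) ≤
        7 * (1 - α) ^ (-(7 / 4) : ℝ) * ‖P‖ ^ (7 / 2 : ℝ) * sysDist c A B A' B' ∧
      matNorm c (B * (gain Ru A' B' P' - gain Ru A B P)) ≤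
        8 * (1 - α) ^ (-(7 / 4) : ℝ) * ‖P‖ ^ (7 / 2 : ℝ) * sysDist c A B A' B' ∧
      matNorm c (psdSqrt P * B * (gain Ru A' B' P' - gain Ru A B P)) ≤
        9 * (1 - α) ^ (-(7 / 4) : ℝ) * ‖P‖ ^ (7 / 2 : ℝ) * sysDist c A B A' B' := by
  have he := sysDist_nonneg c A A' B B'
  have hpos : 0 ≤ (1 - α) ^ (-(7 / 4) : ℝ) * ‖P‖ ^ (7 / 2 : ℝ) * sysDist c A B A' B' :=
    mul_nonneg (mul_nonneg (Real.rpow_nonneg (by linarith) _) (by positivity)) he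
  rcases isEmpty_or_nonempty (Fin n)
  · simp only [matNorm_eq_zero_of_isEmpty]
    refine ⟨?_, ?_, ?_, ?_⟩ <;> linarith
  have hs1 : 1 ≤ √‖P‖ := Real.one_le_sqrt.mpr (h.one_le_norm hRx hRu)
  have hweighted := (h.sqrt_norm_mul_matNorm_psdSqrt_inputWeight_mul_gain_sub_le c h' hRx hRu).trans
    (mul_le_mul_of_nonneg_left (mul_le_mul_of_nonneg_right
      (h.norm_mul_norm_sq_le h' hRx hRu hα hα1) he) (by norm_num))
  have hle := le_mul_of_one_le_left (matNorm_nonneg c (psdSqrt (inputWeight Ru B' P') *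
    (gain Ru A' B' P' - gain Ru A B P))) hs1
  have hBE := matNorm_input_mul_le_of_norm_input_sub_le c hRu (h'.one_le hRx hRu)
    (h.norm_input_sub_le hRx hRu hα hα1) (gain Ru A' B' P' - gain Ru A B P)
  refine ⟨?_, ?_, ?_, ?_⟩
  · linarith [matNorm_le_matNorm_psdSqrt_mul c (one_le_inputWeight hRu h'.nonneg B')
      (gain Ru A' B' P' - gain Ru A B P)]
  · linarith [matNorm_psdSqrt_mul_le_matNorm_psdSqrt_inputWeight_mul c hRu h'.nonneg B'
      (gain Ru A' B' P' - gain Ru A B P)]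
  · linarith
  · rw [Matrix.mul_assoc]
    linarith [matNorm_mul_le_of_le_left (norm_psdSqrt h.nonneg).le hBE]

end IsDARESolution

end Perturbation

end LQR

theorem mainTheorem4 {n m : ℕ}
    (Rx : Matrix (Fin n) (Fin n) ℝ) (Ru : Matrix (Fin m) (Fin m) ℝ)
    (hRx : (Rx - 1).PosSemidef) (hRu : (Ru - 1).PosSemidef)
    (A : Matrix (Fin n) (Fin n) ℝ) (B : Matrix (Fin n) (Fin m) ℝ)
    (hAB : LQR.IsStabilizable A B)
    (A' : Matrix (Fin n) (Fin n) ℝ) (B' : Matrix (Fin n) (Fin m) ℝ)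
    (P : Matrix (Fin n) (Fin n) ℝ) (hP : P = LQR.PInf Rx Ru A B)
    (K : Matrix (Fin m) (Fin n) ℝ) (hK : K = LQR.KInf Rx Ru A B)
    (ε : LQR.NormKind → ℝ) (hε : ∀ c, ε c = LQR.sysDist c A B A' B')
    (α : ℝ) (hα : α = 8 * LQR.opNorm P ^ 2 * ε .op) (hα1 : α < 1) :
    LQR.IsStabilizable A' B' ∧
    (∃! P', LQR.IsDARESolution Rx Ru A' B' P') ∧
    LQR.opNorm (LQR.PInf Rx Ru A' B') ≤ (1 - α) ^ (-(1 / 2) : ℝ) * LQR.opNorm P ∧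
    (∀ c : LQR.NormKind,
      LQR.matNorm c (LQR.KInf Rx Ru A' B' - K) ≤
        7 * (1 - α) ^ (-(7 / 4) : ℝ) * LQR.opNorm P ^ (7 / 2 : ℝ) * ε c ∧
      LQR.matNorm c (LQR.psdSqrt Ru * (LQR.KInf Rx Ru A' B' - K)) ≤
        7 * (1 - α) ^ (-(7 / 4) : ℝ) * LQR.opNorm P ^ (7 / 2 : ℝ) * ε c ∧
      LQR.matNorm c (B * (LQR.KInf Rx Ru A' B' - K)) ≤
        8 * (1 - α) ^ (-(7 / 4) : ℝ) * LQR.opNorm P ^ (7 / 2 : ℝ) * ε c ∧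
      (ε .op ≤ 32 * LQR.opNorm P ^ 3 →
        LQR.matNorm c (LQR.psdSqrt P * B * (LQR.KInf Rx Ru A' B' - K)) ≤
          9 * (1 - α) ^ (-(7 / 4) : ℝ) * LQR.opNorm P ^ (7 / 2 : ℝ) * ε c)) := by
  subst hP hK
  obtain rfl : ε = fun c => LQR.sysDist c A B A' B' := funext hε
  have hRx1 := Matrix.le_iff.mpr hRx
  have hRu1 := Matrix.le_iff.mpr hRu
  have h := LQR.isDARESolution_PInf (hAB.existsUnique_isDARESolution hRx1 hRu1).exists
  have hcert := h.isLyapunovCertificate_perturbed hRx1 hRu1 hα.ge hα1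
  have hex := hcert.existsUnique_isDARESolution hRx1 hRu1
  have h' := LQR.isDARESolution_PInf hex.exists
  refine ⟨hcert.isStabilizable hRx1 hRu1, hex,
    h.norm_le_rpow_mul_norm h' hRx1 hRu1 hα.ge hα1, fun c => ?_⟩
  rw [LQR.KInf_eq_gain, LQR.KInf_eq_gain]
  obtain ⟨hE, hRuE, hBE, hPBE⟩ := h.matNorm_gain_sub_le c h' hRx1 hRu1 hα.ge hα1
  exact ⟨hE, hRuE, hBE, fun _ => hPBE⟩
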